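/- A binary code $C\subseteq\mathbb F_2^{3\ell}$, with words written as $(c_{0,0},\dots,c_{0,\ell-1},c_{1,0},\dots,c_{1,\ell-1},c_{2,0},\dots,c_{2,\ell-1})$, is called *cubic* if it is linear and invariant under the cyclic shift by $\ell$ places. A self-dual binary code (with respect to the Euclidean inner product) is of *Type I* if it has a codeword whose Hamming weight is not divisible by $4$. Two codes are *equivalent* if they differ only by a permutation of the coordinates. For an integer $\alpha\ge 0$ we say that a binary code of length $66$ has weight enumerator $W_1$ with parameter $\alpha$ if its Hamming weight enumerator is $$W_1 = 1+(858+8\alpha)y^{12}+(18678-24\alpha)y^{14}+\cdots ,$$ where the terms not displayed have degree at least $16$. Let $$A=\{6\}\cup\{8,9,\dots,54\}\cup\{56,57,59,60,62,65,68,69,71\},\qquad P=\{17,21,23,26,30,43,46\},$$ so that $|A|=57$ and $|A\setminus P|=50$. **Theorem.** There are codes $C_\alpha\subseteq\mathbb F_2^{66}$ ($\alpha\in A$) such that: 1. each $C_\alpha$ is a binary cubic (that is, $22$-quasi-cyclic) self-dual $[66,33,12]$ code of Type I with weight enumerator $W_1$ with parameter $\alpha$; moreover it arises from the cubic construction $$C_\alpha=\{(x+a\mid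 x+b\mid x+a+b) : x\in C_1,\ a+\omega b\in C_2\}$$ for some Type I self-dual binary code $C_1$ of length $22$ and some linear code $C_2$ of length $22$ over $\mathbb F_4=\mathbb F_2(\omega)$, $\omega^2+\omega+1=0$, that is self-dual with respect to the Hermitian inner product $\sum_j u_j v_j^2$; 2. the $57$ codes $C_\alpha$ are pairwise inequivalent; 3. the $50$ codes $C_\alpha$ with $\alpha\in A\setminus P$ are new: none of them is equivalent to a code with weight enumerator $W_1$ with a parameter in $P$, the set of parameters of the previously known binary cubic self-dual $[66,33,12]$ codes. -/

import Mathlib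

namespace CubicCode

/-- A binary linear code whose coordinates are indexed by `ι`; its length is the size of `ι`. -/
abbrev BinaryCode (ι : Type*) := Submodule (ZMod 2) (ι → ZMod 2)

/-- `C` is an `[n, k, d]` code: length `n`, dimension `k`, and `d` is the minimum Hamming
distance between distinct codewords. -/
def HasParameters {ι : Type*} [Fintype ι] (C : BinaryCode ι) (n k d : ℕ) : Prop :=
  Fintype.card ι = n ∧ Module.finrank (ZMod 2) C = k ∧
    IsLeast {r : ℕ | ∃ u ∈ C, ∃ v ∈ C, u ≠ v ∧ hammingDist u v = r} d

/-- The code `C` equals its dual with respect to the Euclidean inner product. -/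
def IsSelfDual {ι : Type*} [Fintype ι] (C : BinaryCode ι) : Prop :=
  ∀ u : ι → ZMod 2, u ∈ C ↔ ∀ v ∈ C, ∑ i, u i * v i = 0

/-- A self-dual code of Type I (singly-even): some codeword has weight not divisible by `4`. -/
def IsTypeI {ι : Type*} [Fintype ι] (C : BinaryCode ι) : Prop :=
  IsSelfDual C ∧ ∃ c ∈ C, ¬ 4 ∣ hammingNorm c

/-- Equivalence up to a permutation of the coordinates. -/
def Equivalent {ι : Type*} (C D : BinaryCode ι) : Prop :=
  ∃ σ : Equiv.Perm ι, ∀ c : ι → ZMod 2, c ∈ D ↔ c ∘ σ ∈ C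

/-- The number `A_i` of codewords of Hamming weight `i`. -/
noncomputable def weightCount {ι : Type*} [Fintype ι] (C : BinaryCode ι) (i : ℕ) : ℕ :=
  Set.ncard {c : ι → ZMod 2 | c ∈ C ∧ hammingNorm c = i}

/-- The Hamming weight enumerator `∑ A_i y^i`, where `i` runs from `0` to the length. -/
noncomputable def weightEnumerator {ι : Type*} [Fintype ι] (C : BinaryCode ι) :
    Polynomial ℤ :=
  ∑ i ∈ Finset.range (Fintype.card ι + 1), Polynomial.monomial i (weightCount C i : ℤ)

/-- The weight enumerator of `C` has the form
`W₁ = 1 + (858 + 8 α) y ^ 12 + (18678 - 24 α) y ^ 14 + ⋯`,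
the terms not displayed having degree at least `16`. -/
def HasW1 {ι : Type*} [Fintype ι] (C : BinaryCode ι) (α : ℕ) : Prop :=
  ∀ i < 16, (weightEnumerator C).coeff i =
    (1 + Polynomial.monomial 12 (858 + 8 * (α : ℤ)) +
      Polynomial.monomial 14 (18678 - 24 * (α : ℤ)) : Polynomial ℤ).coeff i

/-- Binary cubic codes: codes of length `3 ℓ`, with words
`(c₀₀, …, c₀₍ℓ₋₁₎, c₁₀, …, c₁₍ℓ₋₁₎, c₂₀, …, c₂₍ℓ₋₁₎)`, that are `ℓ`-quasi-cyclic, i.e. invariant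
under the shift by `ℓ` places (subtraction in `Fin 3` is modulo `3`). -/
def IsCubic {l : ℕ} (C : BinaryCode (Fin 3 × Fin l)) : Prop :=
  ∀ c ∈ C, (fun p : Fin 3 × Fin l => c (p.1 - 1, p.2)) ∈ C

/-- The field `𝔽₄ = 𝔽₂[Y] / (Y² + Y + 1)`. -/
abbrev F4 : Type :=
  AdjoinRoot (Polynomial.X ^ 2 + Polynomial.X + 1 : Polynomial (ZMod 2))

/-- The generator `ω` of `𝔽₄` over `𝔽₂`, with `ω² + ω + 1 = 0`. -/
noncomputable def omega : F4 := AdjoinRoot.root _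

/-- A quaternary linear code that equals its dual with respect to the Hermitian inner product
`∑ x_j * conj y_j`; the conjugation of `𝔽₄` is squaring. -/
def IsHermitianSelfDual {l : ℕ} (C : Submodule F4 (Fin l → F4)) : Prop :=
  ∀ u : Fin l → F4, u ∈ C ↔ ∀ v ∈ C, ∑ j, u j * v j ^ 2 = 0

/-- The cubic construction
`{(x + a | x + b | x + a + b) : x ∈ C₁, a + ω b ∈ C₂}`. -/
def cubicConstruction {l : ℕ} (C₁ : BinaryCode (Fin l)) (C₂ : Submodule F4 (Fin l → F4)) :
    BinaryCode (Fin 3 × Fin l) where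
  carrier := {c | ∃ x a b : Fin l → ZMod 2, x ∈ C₁ ∧
    (fun j => algebraMap (ZMod 2) F4 (a j) + omega * algebraMap (ZMod 2) F4 (b j)) ∈ C₂ ∧
    (∀ j, c (0, j) = x j + a j) ∧ (∀ j, c (1, j) = x j + b j) ∧
    (∀ j, c (2, j) = x j + a j + b j)}
  zero_mem' := by
    refine ⟨0, 0, 0, C₁.zero_mem, ?_, by simp, by simp, by simp⟩
    convert C₂.zero_mem using 1
    funext j
    simp
  add_mem' := by
    rintro c d ⟨x, a, b, hx, hab, h0, h1, h2⟩ ⟨x', a', b', hx', hab', h0', h1', h2'⟩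
    refine ⟨x + x', a + a', b + b', C₁.add_mem hx hx', ?_, ?_, ?_, ?_⟩
    · convert C₂.add_mem hab hab' using 1
      funext j
      simp only [Pi.add_apply, map_add]
      ring
    · intro j
      simp only [Pi.add_apply, h0, h0']
      ring
    · intro j
      simp only [Pi.add_apply, h1, h1']
      ring
    · intro j
      simp only [Pi.add_apply, h2, h2']
      ring
  smul_mem' := by
    rintro r c ⟨x, a, b, hx, hab, h0, h1, h2⟩
    refine ⟨r • x, r • a, r • b, C₁.smul_mem r hx, ?_, ?_, ?_, ?_⟩
    · convert C₂.smul_mem (algebraMap (ZMod 2) F4 r) hab using 1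
      funext j
      simp only [Pi.smul_apply, smul_eq_mul, map_mul]
      ring
    · intro j
      simp only [Pi.smul_apply, smul_eq_mul, h0]
      ring
    · intro j
      simp only [Pi.smul_apply, smul_eq_mul, h1]
      ring
    · intro j
      simp only [Pi.smul_apply, smul_eq_mul, h2]
      ring

/-- The values of `α` for which a code is found. -/
def foundValues : Finset ℕ :=
  {6} ∪ Finset.Icc 8 54 ∪ {56, 57, 59, 60, 62, 65, 68, 69, 71}

/-- The values of `α` of the previously known codes. -/
def previousValues : Finset ℕ := {17, 21, 23, 26, 30, 43, 46}

end CubicCode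

/-!
All codes come from one Hermitian self-dual code `C₂` of length 22 over `𝔽₄` with minimum weight 8,
`quaternaryCode`, and from one self-dual binary code `C₁` for each `α`, listed in `codeTable`. That
the cubic construction of self-dual codes is self-dual, quasi-cyclic, and of Type I if `C₁` is,
holds because `(x + a | x + b | x + a + b)` decomposes the space into an orthogonal sum of `𝔽₂ ^ l`
and `𝔽₄ ^ l`, on which the Euclidean inner product induces the Euclidean inner product and the
trace of the Hermitian one, and on which the shift acts as the identity and as a scalar.

The weight enumerator is found without enumerating the `2 ^ 33` codewords. By the MacWilliams
identity for the translate of a self-dual code by a vector of its shadow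
(`IsSelfDual.sum_translateCount_mul_krawtchouk`), the numbers of words of weight 12 and 14 are
linear combinations of the numbers `A₀, A₂, …, A₁₀` of words of smaller weight and the numbers
`B₁, B₅, B₉` of vectors of small weight in the shadow; see `IsSelfDual.weightCount_of_shadow`. If
`A₂ = ⋯ = A₁₀ = 0` and `B₁ = B₅ = 0`, then the weight enumerator is `W₁` with parameter
`B₉`. The shadow of the cubic code is again described by `C₁` and `C₂`: it is the translate by
`(y | y | y)`, where the inner product of `y` with `x ∈ C₁` tells whether 4 divides the weight of
`x`.

What remains is to count, for a given `w ≤ 10`, the words of weight `w` in a cubic code or its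
shadow. The word with binary part `x` and quaternary part `u` has weight
`|x| + 2 |supp x Δ supp u|` (`hammingNorm_eq_cubicWeight`), which is at least the weight
of `u`. Hence only words `u` of weight at most 10 matter, and those do not depend on `α`. They are
found by computing the supports
of all `2 ^ 22` words of `C₂` simultaneously with bitwise operations on natural numbers that have
one bit for each word (`plane`, `weightMasks`). For each support `T` the vectors `x` that lead to a
word of weight `w` are listed (`near`), and those that satisfy the affine conditions defining `C₁`,
or its shadow, are counted, again with one number holding all candidates (`MaskTree.hits`). The
lemma `hits_add_hits` says that this computation counts what it should;
`isCertified_of_mem_codeTable` carries it out.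

The parameter `α` can be read off the number of words of weight 12, which is invariant under
permutations of the coordinates. This separates the codes from each other and from the codes with
other parameters.
-/

namespace CubicCode

open Finset Polynomial

/-! ### Characters, self-dual codes and shadows -/

/-- The nontrivial character `t ↦ (-1) ^ t` of `𝔽₂`, with integer values. -/
def signChar (t : ZMod 2) : ℤ := if t = 0 then 1 else -1

lemma eq_zero_or_one : ∀ a : ZMod 2, a = 0 ∨ a = 1 := by decide

lemma signChar_add : ∀ a b : ZMod 2, signChar (a + b) = signChar a * signChar b := by decide

lemma signChar_sum {ι : Type*} (s : Finset ι) (f : ι → ZMod 2) :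
    signChar (∑ i ∈ s, f i) = ∏ i ∈ s, signChar (f i) := by
  classical
  induction s using Finset.induction_on with
  | empty => rfl
  | insert a s ha ih => rw [sum_insert ha, prod_insert ha, signChar_add, ih]

section
variable {ι : Type*} [Fintype ι]

lemma hammingNorm_eq_sum (x : ι → ZMod 2) : hammingNorm x = ∑ i, if x i = 0 then 0 else 1 := by
  simp [hammingNorm, card_filter]

/-- `|x + y| = |x| + |y| - 2 |x ∩ y|`, without subtraction. -/
lemma hammingNorm_add_add (x y : ι → ZMod 2) :
    hammingNorm (x + y) + 2 * hammingNorm (x * y) = hammingNorm x + hammingNorm y := by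
  simp only [hammingNorm_eq_sum, mul_sum, ← sum_add_distrib, Pi.add_apply, Pi.mul_apply]
  refine sum_congr rfl fun i _ => ?_
  rcases eq_zero_or_one (x i) with h | h <;> rcases eq_zero_or_one (y i) with h' | h' <;>
    simp only [h, h'] <;> rfl

lemma natCast_hammingNorm (x : ι → ZMod 2) : (hammingNorm x : ZMod 2) = ∑ i, x i := by
  rw [hammingNorm_eq_sum]
  push_cast
  refine sum_congr rfl fun i _ => ?_
  rcases eq_zero_or_one (x i) with h | h <;> simp [h]

lemma two_dvd_hammingNorm_iff (x : ι → ZMod 2) : 2 ∣ hammingNorm x ↔ ∑ i, x i = 0 := by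
  rw [← natCast_hammingNorm, ZMod.natCast_eq_zero_iff]

lemma IsSelfDual.sum_mul_eq_zero {C : BinaryCode ι} (hC : IsSelfDual C) {c d : ι → ZMod 2}
    (hc : c ∈ C) (hd : d ∈ C) : ∑ i, c i * d i = 0 :=
  (hC c).1 hc d hd

lemma IsSelfDual.two_dvd_hammingNorm {C : BinaryCode ι} (hC : IsSelfDual C) {c : ι → ZMod 2}
    (hc : c ∈ C) : 2 ∣ hammingNorm c := by
  rw [two_dvd_hammingNorm_iff, ← hC.sum_mul_eq_zero hc hc]
  refine sum_congr rfl fun i _ => ?_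
  generalize c i = a
  revert a
  decide

lemma IsSelfDual.one_mem {C : BinaryCode ι} (hC : IsSelfDual C) : (1 : ι → ZMod 2) ∈ C := by
  rw [hC]
  intro v hv
  simpa using (two_dvd_hammingNorm_iff v).1 (hC.two_dvd_hammingNorm hv)

/-- The weights in the translate `s + D` are congruent to the weight of `s` modulo four. -/
lemma hammingNorm_add_modEq {D : BinaryCode ι} (hD : IsSelfDual D)
    {s : ι → ZMod 2} (hs : ∀ c ∈ D, ∑ i, s i * c i = 0 ↔ 4 ∣ hammingNorm c)
    {c : ι → ZMod 2} (hc : c ∈ D) : hammingNorm (s + c) % 4 = hammingNorm s % 4 := by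
  have h := hammingNorm_add_add s c
  have h2 := hD.two_dvd_hammingNorm hc
  have h3 := two_dvd_hammingNorm_iff (s * c)
  simp only [Pi.mul_apply] at h3
  rw [hs c hc] at h3
  omega

lemma IsSelfDual.two_mul_finrank {C : BinaryCode ι} (hC : IsSelfDual C) :
    2 * Module.finrank (ZMod 2) C = Fintype.card ι := by
  classical
  let B : LinearMap.BilinForm (ZMod 2) (ι → ZMod 2) :=
    LinearMap.mk₂ (ZMod 2) (fun u v => ∑ i, u i * v i)
      (fun u u' v => by simp [add_mul, sum_add_distrib])
      (fun r u v => by simp [mul_sum, mul_assoc])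
      (fun u v v' => by simp [mul_add, sum_add_distrib])
      (fun r u v => by simp [mul_sum, mul_left_comm])
  have hB : ∀ u v, B u v = ∑ i, u i * v i := fun u v => rfl
  have hrefl : B.IsRefl := fun u v h => by
    rw [hB] at h ⊢
    simpa [mul_comm] using h
  have hnd : B.Nondegenerate := by
    refine (LinearMap.IsRefl.nondegenerate_iff_separatingLeft hrefl).2 fun u h => ?_
    funext i
    simpa [hB, Pi.single_apply] using h (Pi.single i 1)
  have horth : B.orthogonal C = C := by
    ext u
    rw [LinearMap.BilinForm.mem_orthogonal_iff, hC]
    refine forall₂_congr fun v _ => ?_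
    rw [hB]
    simp [mul_comm]
  have h := LinearMap.BilinForm.finrank_orthogonal hnd C
  have hle := Submodule.finrank_le C
  rw [horth, Module.finrank_pi] at h
  rw [Module.finrank_pi] at hle
  omega

end

section
variable {ι : Type*} [Fintype ι] [DecidableEq ι]

/-- The generating function of the vectors `v` by weight, twisted by the character `v ↦ (-1)^(s·v)`,
factors over the coordinates. -/
lemma sum_signChar_mul_X_pow (s : ι → ZMod 2) :
    ∑ v : ι → ZMod 2, C (signChar (∑ i, s i * v i)) * (X : ℤ[X]) ^ hammingNorm v =
      (1 - X) ^ hammingNorm s * (1 + X) ^ (Fintype.card ι - hammingNorm s) := by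
  have h1 : ∀ v : ι → ZMod 2, C (signChar (∑ i, s i * v i)) * (X : ℤ[X]) ^ hammingNorm v =
      ∏ i, (C (signChar (s i * v i)) * X ^ (if v i = 0 then 0 else 1)) := by
    intro v
    rw [signChar_sum, map_prod, hammingNorm_eq_sum, ← prod_pow_eq_pow_sum, prod_mul_distrib]
  have h2 : ∀ i, ∑ t : ZMod 2, (C (signChar (s i * t)) * (X : ℤ[X]) ^ (if t = 0 then 0 else 1)) =
      if s i = 0 then 1 + X else 1 - X := by
    intro i
    generalize s i = a
    have : ∀ a : ZMod 2, a = 0 ∨ a = 1 := by decide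
    have hu : (univ : Finset (ZMod 2)) = {0, 1} := rfl
    rw [hu, sum_pair (by decide)]
    rcases this a with rfl | rfl
    · simp [signChar]
    · simp [signChar, sub_eq_add_neg]
  have h3 := Finset.prod_univ_sum (fun _ : ι => (univ : Finset (ZMod 2)))
    (fun i t => C (signChar (s i * t)) * (X : ℤ[X]) ^ (if t = 0 then 0 else 1))
  rw [Fintype.piFinset_univ] at h3
  rw [sum_congr rfl fun v _ => h1 v, ← h3, prod_congr rfl fun i _ => h2 i, prod_ite, prod_const,
    prod_const, mul_comm]
  congr 2
  have := card_filter_add_card_filter_not (s := (univ : Finset ι)) (fun i => s i = 0)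
  rw [card_univ] at this
  simp only [hammingNorm, ne_eq]
  omega

open Classical in
/-- Orthogonality of characters on a self-dual code. -/
lemma IsSelfDual.sum_signChar {D : BinaryCode ι} (hD : IsSelfDual D) (v : ι → ZMod 2) :
    ∑ c ∈ univ.filter (· ∈ D), signChar (∑ i, c i * v i) =
      if v ∈ D then (#(univ.filter (· ∈ D)) : ℤ) else 0 := by
  split_ifs with hv
  · rw [sum_congr rfl fun c hc => ?_, sum_const, nsmul_eq_mul, mul_one]
    rw [hD.sum_mul_eq_zero (mem_filter.1 hc).2 hv]
    rfl
  · obtain ⟨d, hd, hdv⟩ : ∃ d ∈ D, ∑ i, d i * v i ≠ 0 := by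
      by_contra! h
      exact hv ((hD v).2 fun d hd => by simpa [mul_comm] using h d hd)
    have hneg : signChar (∑ i, d i * v i) = -1 := if_neg hdv
    -- translation by `d` permutes the code and changes the sign of every summand
    have h : ∑ c ∈ univ.filter (· ∈ D), signChar (∑ i, c i * v i) =
        ∑ c ∈ univ.filter (· ∈ D), signChar (∑ i, (d + c) i * v i) := by
      symm
      refine sum_equiv (Equiv.addLeft d) (fun c => ?_) fun c _ => rfl
      simp [D.add_mem_iff_right hd]
    simp only [Pi.add_apply, add_mul, sum_add_distrib, signChar_add, hneg, ← mul_sum] at h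
    linarith

open Classical in
/-- The MacWilliams identity for a translate `s + D` of a self-dual code. -/
lemma IsSelfDual.sum_translate {D : BinaryCode ι} (hD : IsSelfDual D) (s : ι → ZMod 2) :
    ∑ c ∈ univ.filter (· ∈ D), (1 - X : ℤ[X]) ^ hammingNorm (s + c) *
        (1 + X) ^ (Fintype.card ι - hammingNorm (s + c)) =
      C (#(univ.filter (· ∈ D)) : ℤ) *
        ∑ c ∈ univ.filter (· ∈ D), C (signChar (∑ i, s i * c i)) * X ^ hammingNorm c := by
  simp only [← sum_signChar_mul_X_pow, Pi.add_apply, add_mul, sum_add_distrib, signChar_add,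
    map_mul]
  rw [sum_comm, mul_sum, sum_filter]
  refine sum_congr rfl fun v _ => ?_
  have h := hD.sum_signChar v
  calc _ = C (signChar (∑ i, s i * v i)) *
        C (∑ c ∈ univ.filter (· ∈ D), signChar (∑ i, c i * v i)) * X ^ hammingNorm v := by
        rw [map_sum, mul_sum, sum_mul]
    _ = _ := by
        rw [h]
        split_ifs
        · ring
        · simp

open Classical in
/-- The number of vectors of weight `k` in the translate `s + D`. -/
noncomputable def translateCount (D : BinaryCode ι) (s : ι → ZMod 2) (k : ℕ) : ℕ :=
  #(univ.filter fun c => c ∈ D ∧ hammingNorm (s + c) = k)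

open Classical in
lemma weightCount_eq_card (D : BinaryCode ι) (k : ℕ) :
    weightCount D k = #(univ.filter fun c => c ∈ D ∧ hammingNorm c = k) := by
  rw [weightCount, ← Set.ncard_coe_finset]
  congr 1
  ext
  simp

lemma translateCount_zero (D : BinaryCode ι) (k : ℕ) : translateCount D 0 k = weightCount D k := by
  classical
  rw [weightCount_eq_card, translateCount]
  refine congrArg card (filter_congr fun c _ => ?_)
  rw [zero_add]

lemma weightCount_zero (D : BinaryCode ι) : weightCount D 0 = 1 := by
  classical
  rw [weightCount_eq_card, card_eq_one]
  refine ⟨0, ?_⟩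
  ext c
  simp only [hammingNorm_eq_zero, mem_filter, mem_univ, true_and, mem_singleton]
  exact ⟨fun h => h.2, fun h => ⟨h ▸ D.zero_mem, h⟩⟩

/-- The Krawtchouk number: the coefficient of `X ^ i` in `(1 - X) ^ k * (1 + X) ^ (n - k)`. -/
def krawtchouk (n i k : ℕ) : ℤ :=
  ∑ j ∈ range (i + 1), (-1) ^ j * (k.choose j : ℤ) * ((n - k).choose (i - j) : ℤ)

lemma coeff_one_sub_X_pow (k j : ℕ) :
    ((1 - X : ℤ[X]) ^ k).coeff j = (-1) ^ j * (k.choose j : ℤ) := by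
  have : (1 - X : ℤ[X]) ^ k = ((1 + X : ℤ[X]) ^ k).comp (C (-1) * X) := by
    simp [sub_eq_add_neg]
  rw [this, comp_C_mul_X_coeff, coeff_one_add_X_pow, mul_comm]

lemma coeff_one_sub_X_pow_mul (n i k : ℕ) :
    ((1 - X : ℤ[X]) ^ k * (1 + X) ^ (n - k)).coeff i = krawtchouk n i k := by
  rw [coeff_mul, Nat.sum_antidiagonal_eq_sum_range_succ_mk, krawtchouk]
  simp only [coeff_one_sub_X_pow, coeff_one_add_X_pow]

/-- When `s` detects divisibility of the weights by four, the weight distribution of `s + D`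
determines that of `D`. -/
lemma IsSelfDual.sum_translateCount_mul_krawtchouk {D : BinaryCode ι} (hD : IsSelfDual D)
    {s : ι → ZMod 2} (hs : ∀ c ∈ D, ∑ i, s i * c i = 0 ↔ 4 ∣ hammingNorm c) (i : ℕ) :
    ∑ k ∈ range (Fintype.card ι + 1), (translateCount D s k : ℤ) * krawtchouk (Fintype.card ι) i k =
      2 ^ Module.finrank (ZMod 2) D * ((if 4 ∣ i then 1 else -1) * weightCount D i) := by
  classical
  have hcard : #(univ.filter (· ∈ D)) = 2 ^ Module.finrank (ZMod 2) D := by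
    rw [← Fintype.card_subtype, ← Nat.card_eq_fintype_card]
    have := Module.natCard_eq_pow_finrank (K := ZMod 2) (V := D)
    rw [Nat.card_zmod] at this
    exact this
  have h := congrArg (fun p : ℤ[X] => p.coeff i) (hD.sum_translate s)
  simp only [finsetSum_coeff, coeff_one_sub_X_pow_mul, coeff_C_mul, coeff_X_pow] at h
  rw [hcard] at h
  have hl : ∑ k ∈ range (Fintype.card ι + 1),
      (translateCount D s k : ℤ) * krawtchouk (Fintype.card ι) i k =
      ∑ c ∈ univ.filter (· ∈ D), krawtchouk (Fintype.card ι) i (hammingNorm (s + c)) := by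
    rw [← sum_fiberwise_of_maps_to (s := univ.filter (· ∈ D)) (g := fun c => hammingNorm (s + c))
      (t := range (Fintype.card ι + 1))
      (fun c _ => mem_range.2 (Nat.lt_succ_of_le hammingNorm_le_card_fintype))]
    refine sum_congr rfl fun k _ => ?_
    rw [filter_filter, sum_congr rfl (g := fun _ => krawtchouk (Fintype.card ι) i k), sum_const,
      nsmul_eq_mul, translateCount]
    intro c hc
    rw [(mem_filter.1 hc).2.2]
  rw [hl, h]
  push_cast
  congr 1
  rw [weightCount_eq_card, card_filter, Nat.cast_sum, mul_sum, sum_filter]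
  refine sum_congr rfl fun c _ => ?_
  by_cases hc : c ∈ D
  · by_cases hi : i = hammingNorm c
    · subst hi
      simp [hc, signChar, hs c hc]
    · simp [hc, hi, Ne.symm hi]
  · simp [hc]

/-- A translate of a code that contains the all-one vector has a symmetric weight distribution. -/
lemma translateCount_symm {D : BinaryCode ι} (h1 : (1 : ι → ZMod 2) ∈ D) (s : ι → ZMod 2) {k : ℕ}
    (hk : k ≤ Fintype.card ι) :
    translateCount D s (Fintype.card ι - k) = translateCount D s k := by
  classical
  have hn : ∀ x : ι → ZMod 2, hammingNorm (x + 1) = Fintype.card ι - hammingNorm x := by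
    intro x
    have h := hammingNorm_add_add x 1
    have h' : hammingNorm (1 : ι → ZMod 2) = Fintype.card ι := by
      simp [hammingNorm]
    rw [mul_one, h'] at h
    omega
  rw [translateCount, translateCount]
  refine card_equiv (Equiv.addRight 1) fun c => ?_
  have := hammingNorm_le_card_fintype (x := s + c)
  simp only [mem_filter, mem_univ, true_and, Equiv.coe_addRight, D.add_mem_iff_left h1,
    ← add_assoc, hn]
  refine and_congr_right fun _ => ?_
  omega

/-- If a self-dual code of length 66 has minimum weight at least 12 and its shadow `s + D` has no
vectors of weight 1 and 5, then the number of vectors of weight 9 in the shadow determines the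
weight distribution of the code up to weight 14. -/
theorem IsSelfDual.weightCount_of_shadow {D : BinaryCode ι} (hD : IsSelfDual D)
    (hn : Fintype.card ι = 66) {s : ι → ZMod 2}
    (hs : ∀ c ∈ D, ∑ i, s i * c i = 0 ↔ 4 ∣ hammingNorm c) (hs4 : hammingNorm s % 4 = 1)
    (h2 : weightCount D 2 = 0) (h4 : weightCount D 4 = 0) (h6 : weightCount D 6 = 0)
    (h8 : weightCount D 8 = 0) (h10 : weightCount D 10 = 0)
    (hs1 : translateCount D s 1 = 0) (hs5 : translateCount D s 5 = 0) :
    (weightCount D 12 : ℤ) = 858 + 8 * translateCount D s 9 ∧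
      (weightCount D 14 : ℤ) = 18678 - 24 * translateCount D s 9 := by
  classical
  have hz : ∀ k, k % 4 ≠ 1 → translateCount D s k = 0 := by
    intro k hk
    rw [translateCount, card_eq_zero, filter_eq_empty_iff]
    rintro c - ⟨hc, rfl⟩
    exact hk (by rw [hammingNorm_add_modEq hD hs hc, hs4])
  have h0 := weightCount_zero D
  have hr := hD.two_mul_finrank
  have hsym : ∀ k ≤ 66, translateCount D s (66 - k) = translateCount D s k := by
    intro k hk
    rw [← hn] at hk ⊢
    exact translateCount_symm hD.one_mem s hk
  have key := hD.sum_translateCount_mul_krawtchouk hs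
  rw [hn] at hr key
  have hr' : Module.finrank (ZMod 2) D = 33 := by omega
  rw [hr'] at key
  have hgen : ∀ (L : ℕ → ℤ) (m : ℤ), (∀ k ∈ range 67, k % 4 = 1 → 12 < k → k < 54 → L k = 0) →
      L 9 = m → L 57 = m →
      ∑ k ∈ range 67, (translateCount D s k : ℤ) * L k = 2 * (m * translateCount D s 9) := by
    intro L m hL h9 h57
    have hk : ∀ k ∈ range 67, (translateCount D s k : ℤ) * L k =
        if k = 9 ∨ k = 57 then m * translateCount D s 9 else 0 := by
      intro k hk
      have hk' := mem_range.1 hk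
      split_ifs with h
      · rcases h with rfl | rfl
        · rw [h9, mul_comm]
        · rw [h57, mul_comm, hsym 9 (by norm_num)]
      · by_cases h4 : k % 4 = 1
        · by_cases h12 : 12 < k ∧ k < 54
          · rw [hL k hk h4 h12.1 h12.2, mul_zero]
          · have : k = 1 ∨ k = 5 ∨ k = 66 - 5 ∨ k = 66 - 1 := by omega
            rcases this with rfl | rfl | rfl | rfl
            · simp [hs1]
            · simp [hs5]
            · simp [hsym 5, hs5]
            · simp [hsym 1, hs1]
        · simp [hz k h4]
    rw [sum_congr rfl hk, ← sum_filter, sum_const]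
    have : #((range 67).filter fun k => k = 9 ∨ k = 57) = 2 := by decide
    rw [this, nsmul_eq_mul]
    push_cast
    ring
  -- The coefficients are chosen to make the combination of Krawtchouk numbers vanish at
  -- `k = 13, 17, …, 53`, where the weight distribution of the shadow is unknown.
  have e12 := hgen (fun k => krawtchouk 66 12 k - (858 * krawtchouk 66 0 k
    - 454 * krawtchouk 66 2 k + 94 * krawtchouk 66 4 k - 53 * krawtchouk 66 6 k
    + krawtchouk 66 8 k - 3 * krawtchouk 66 10 k)) (2 ^ 33 * 4) (by decide +kernel)
    (by decide +kernel) (by decide +kernel)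
  have e14 := hgen (fun k => krawtchouk 66 14 k - (-18678 * krawtchouk 66 0 k
    + 5674 * krawtchouk 66 2 k - 1749 * krawtchouk 66 4 k + 318 * krawtchouk 66 6 k
    - 75 * krawtchouk 66 8 k - 7 * krawtchouk 66 10 k)) (2 ^ 33 * 12) (by decide +kernel)
    (by decide +kernel) (by decide +kernel)
  have hmul : ∀ (a : ℤ) (i : ℕ),
      ∑ k ∈ range 67, (translateCount D s k : ℤ) * (a * krawtchouk 66 i k) =
        a * (2 ^ 33 * ((if 4 ∣ i then 1 else -1) * weightCount D i)) := by
    intro a i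
    rw [← key i, mul_sum]
    exact sum_congr rfl fun k _ => by ring
  simp only [mul_sub, mul_add, sum_sub_distrib, sum_add_distrib, hmul, key] at e12 e14
  norm_num [h0, h2, h4, h6, h8, h10] at e12 e14
  constructor <;> linarith
end

/-! ### The field with four elements -/

/-- The element `a + ω b` of `𝔽₄`. -/
noncomputable def quaternary (a b : ZMod 2) : F4 :=
  algebraMap (ZMod 2) F4 a + omega * algebraMap (ZMod 2) F4 b

lemma F4_two : (2 : F4) = 0 := by
  have := map_natCast (algebraMap (ZMod 2) F4) 2
  rw [show ((2 : ℕ) : ZMod 2) = 0 from rfl, map_zero] at this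
  exact_mod_cast this.symm

lemma omega_mul_omega : omega * omega = omega + 1 := by
  have h : AdjoinRoot.mk (X ^ 2 + X + 1 : (ZMod 2)[X]) (X ^ 2 + X + 1) = 0 := AdjoinRoot.mk_self
  simp only [map_add, map_pow, AdjoinRoot.mk_X, map_one] at h
  change omega ^ 2 + omega + 1 = 0 at h
  linear_combination h - (omega + 1) * F4_two

lemma quaternary_add (a b c d : ZMod 2) :
    quaternary a b + quaternary c d = quaternary (a + c) (b + d) := by
  simp only [quaternary, map_add]
  ring

lemma quaternary_zero : quaternary 0 0 = 0 := by simp [quaternary]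

lemma quaternary_mul (a b c d : ZMod 2) :
    quaternary a b * quaternary c d = quaternary (a * c + b * d) (a * d + b * c + b * d) := by
  simp only [quaternary, map_add, map_mul]
  linear_combination
    (algebraMap (ZMod 2) F4 b) * (algebraMap (ZMod 2) F4 d) * omega_mul_omega

lemma quaternary_sum {ι : Type*} (s : Finset ι) (f g : ι → ZMod 2) :
    ∑ i ∈ s, quaternary (f i) (g i) = quaternary (∑ i ∈ s, f i) (∑ i ∈ s, g i) := by
  simp only [quaternary, map_sum, mul_sum, sum_add_distrib]

lemma quaternary_mul_sq (a b c d : ZMod 2) :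
    quaternary a b * quaternary c d ^ 2 = quaternary (a * c + a * d + b * d) (a * d + b * c) := by
  have h2 : ∀ t : ZMod 2, t + t = 0 := by decide
  have h3 : ∀ t : ZMod 2, t * t = t := by decide
  rw [show quaternary c d ^ 2 = quaternary c d * quaternary c d from sq _, quaternary_mul,
    quaternary_mul]
  congr 1
  · simp only [h3]
    linear_combination h2 (b * c * d)
  · simp only [h3]
    linear_combination h2 (a * c * d) + h2 (b * c * d) + h2 (b * d)

lemma quaternary_eq_mk (a b : ZMod 2) :
    quaternary a b = AdjoinRoot.mk (X ^ 2 + X + 1 : (ZMod 2)[X]) (C b * X + C a) := by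
  rw [map_add, map_mul, AdjoinRoot.mk_X, AdjoinRoot.mk_C, AdjoinRoot.mk_C, add_comm, mul_comm]
  rfl

lemma quaternary_bijective :
    Function.Bijective fun p : ZMod 2 × ZMod 2 => quaternary p.1 p.2 := by
  have hd : (X ^ 2 + X + 1 : (ZMod 2)[X]).degree = 2 := by compute_degree!
  have hm : (X ^ 2 + X + 1 : (ZMod 2)[X]).Monic := by monicity!
  constructor
  · rintro ⟨a, b⟩ ⟨c, d⟩ h
    simp only [quaternary_eq_mk, AdjoinRoot.mk_eq_mk] at h
    have h' : (C b * X + C a - (C d * X + C c) : (ZMod 2)[X]) = C (b - d) * X + C (a - c) := by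
      simp only [map_sub]
      ring
    rw [h'] at h
    have hz := eq_zero_of_dvd_of_degree_lt h (by
      rw [hd]
      exact degree_linear_lt)
    have h0 := congrArg (fun p => coeff p 0) hz
    have h1 := congrArg (fun p => coeff p 1) hz
    simp [sub_eq_zero] at h0 h1
    simp [h0, h1]
  · intro z
    obtain ⟨p, rfl⟩ := AdjoinRoot.mk_surjective z
    obtain ⟨b, a, hba⟩ := exists_eq_X_add_C_of_natDegree_le_one
      (p := p %ₘ (X ^ 2 + X + 1)) (by
        have hn : (X ^ 2 + X + 1 : (ZMod 2)[X]).natDegree = 2 := by compute_degree!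
        have := natDegree_modByMonic_lt p hm (by
          intro h
          rw [h, natDegree_one] at hn
          exact absurd hn (by decide))
        rw [hn] at this
        omega)
    refine ⟨(a, b), ?_⟩
    dsimp only
    rw [quaternary_eq_mk, ← hba, AdjoinRoot.mk_eq_mk]
    refine ⟨-(p /ₘ (X ^ 2 + X + 1)), ?_⟩
    linear_combination modByMonic_add_div p (X ^ 2 + X + 1)

lemma quaternary_inj {a b c d : ZMod 2} : quaternary a b = quaternary c d ↔ a = c ∧ b = d := by
  have := quaternary_bijective.1.eq_iff (a := (a, b)) (b := (c, d))
  simpa using this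

lemma quaternary_eq_zero {a b : ZMod 2} : quaternary a b = 0 ↔ a = 0 ∧ b = 0 := by
  rw [← quaternary_zero, quaternary_inj]

lemma exists_quaternary (z : F4) : ∃ a b, quaternary a b = z := by
  obtain ⟨p, hp⟩ := quaternary_bijective.2 z
  exact ⟨p.1, p.2, hp⟩

lemma exists_quaternary_fun {ι : Type*} (u : ι → F4) :
    ∃ a b : ι → ZMod 2, u = fun j => quaternary (a j) (b j) := by
  choose a b h using fun j => exists_quaternary (u j)
  exact ⟨a, b, funext fun j => (h j).symm⟩

lemma omega_eq : omega = quaternary 0 1 := by simp [quaternary]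

/-! ### The cubic construction -/

section
variable {l : ℕ}

/-- The component `x` of `(x + a | x + b | x + a + b)`. -/
def binaryPart (c : Fin 3 × Fin l → ZMod 2) (j : Fin l) : ZMod 2 := c (0, j) + c (1, j) + c (2, j)

/-- The component `a + ω b` of `(x + a | x + b | x + a + b)`. -/
noncomputable def quaternaryPart (c : Fin 3 × Fin l → ZMod 2) (j : Fin l) : F4 :=
  quaternary (c (1, j) + c (2, j)) (c (0, j) + c (2, j))

/-- The word `(x + a | x + b | x + a + b)`. -/
def cubicWord (x a b : Fin l → ZMod 2) (p : Fin 3 × Fin l) : ZMod 2 :=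
  x p.2 + ![a p.2, b p.2, a p.2 + b p.2] p.1

lemma binaryPart_cubicWord (x a b : Fin l → ZMod 2) : binaryPart (cubicWord x a b) = x := by
  have h : ∀ x a b : ZMod 2, x + a + (x + b) + (x + (a + b)) = x := by decide
  exact funext fun j => h _ _ _

lemma quaternaryPart_cubicWord (x a b : Fin l → ZMod 2) :
    quaternaryPart (cubicWord x a b) = fun j => quaternary (a j) (b j) := by
  have h : ∀ x a b : ZMod 2, x + b + (x + (a + b)) = a ∧ x + a + (x + (a + b)) = b := by decide
  funext j
  exact quaternary_inj.2 (h _ _ _)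

lemma eq_cubicWord (c : Fin 3 × Fin l → ZMod 2) :
    c = cubicWord (binaryPart c) (fun j => c (1, j) + c (2, j)) (fun j => c (0, j) + c (2, j)) := by
  have h : ∀ s t u : ZMod 2, s = s + t + u + (t + u) ∧ t = s + t + u + (s + u) ∧
      u = s + t + u + ((t + u) + (s + u)) := by decide
  funext ⟨i, j⟩
  have := h (c (0, j)) (c (1, j)) (c (2, j))
  fin_cases i
  exacts [this.1, this.2.1, this.2.2]

/-- The decomposition of a word of length `3 l` into its binary and its quaternary part. -/
noncomputable def partsEquiv (l : ℕ) :
    (Fin 3 × Fin l → ZMod 2) ≃ (Fin l → ZMod 2) × (Fin l → F4) :=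
  Equiv.ofBijective (fun c => (binaryPart c, quaternaryPart c)) <| by
    constructor
    · intro c d h
      simp only [Prod.mk.injEq] at h
      rw [eq_cubicWord c, eq_cubicWord d, h.1]
      have h2 := fun j => quaternary_inj.1 (congrFun h.2 j)
      simp only [h2]
    · rintro ⟨x, u⟩
      obtain ⟨a, b, rfl⟩ := exists_quaternary_fun u
      exact ⟨cubicWord x a b,
        Prod.ext (binaryPart_cubicWord x a b) (quaternaryPart_cubicWord x a b)⟩

lemma partsEquiv_apply (c : Fin 3 × Fin l → ZMod 2) :
    partsEquiv l c = (binaryPart c, quaternaryPart c) := rfl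

lemma exists_parts (x : Fin l → ZMod 2) (u : Fin l → F4) :
    ∃ c, binaryPart c = x ∧ quaternaryPart c = u := by
  obtain ⟨c, hc⟩ := (partsEquiv l).surjective (x, u)
  exact ⟨c, congrArg Prod.fst hc, congrArg Prod.snd hc⟩

lemma mem_cubicConstruction {C₁ : BinaryCode (Fin l)} {C₂ : Submodule F4 (Fin l → F4)}
    {c : Fin 3 × Fin l → ZMod 2} :
    c ∈ cubicConstruction C₁ C₂ ↔ binaryPart c ∈ C₁ ∧ quaternaryPart c ∈ C₂ := by
  constructor
  · rintro ⟨x, a, b, hx, hu, h0, h1, h2⟩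
    have : c = cubicWord x a b := by
      funext ⟨i, j⟩
      fin_cases i
      exacts [h0 j, h1 j, (h2 j).trans (add_assoc _ _ _)]
    rw [this, binaryPart_cubicWord, quaternaryPart_cubicWord]
    exact ⟨hx, hu⟩
  · rintro ⟨hx, hu⟩
    refine ⟨binaryPart c, fun j => c (1, j) + c (2, j), fun j => c (0, j) + c (2, j), hx, hu,
      fun j => congrFun (eq_cubicWord c) (0, j), fun j => congrFun (eq_cubicWord c) (1, j),
      fun j => ?_⟩
    rw [add_assoc]
    exact congrFun (eq_cubicWord c) (2, j)

lemma sum_fin_three_prod {M : Type*} [AddCommMonoid M] (f : Fin 3 × Fin l → M) :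
    ∑ p, f p = ∑ j, (f (0, j) + f (1, j) + f (2, j)) := by
  rw [Fintype.sum_prod_type_right]
  exact sum_congr rfl fun j _ => Fin.sum_univ_three _

/-- The symplectic form that the Euclidean inner product induces on the quaternary parts. -/
lemma sum_mul_eq (c d : Fin 3 × Fin l → ZMod 2) :
    ∑ p, c p * d p = ∑ j, binaryPart c j * binaryPart d j +
      ∑ j, ((c (1, j) + c (2, j)) * (d (0, j) + d (2, j)) +
        (c (0, j) + c (2, j)) * (d (1, j) + d (2, j))) := by
  have h : ∀ s t u s' t' u' : ZMod 2, s * s' + t * t' + u * u' =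
      (s + t + u) * (s' + t' + u') + ((t + u) * (s' + u') + (s + u) * (t' + u')) := by decide
  rw [sum_fin_three_prod, ← sum_add_distrib]
  exact sum_congr rfl fun j _ => h _ _ _ _ _ _

lemma isSelfDual_cubicConstruction {C₁ : BinaryCode (Fin l)} {C₂ : Submodule F4 (Fin l → F4)}
    (h₁ : IsSelfDual C₁) (h₂ : IsHermitianSelfDual C₂) : IsSelfDual (cubicConstruction C₁ C₂) := by
  intro c
  rw [mem_cubicConstruction]
  constructor
  · rintro ⟨hx, hu⟩ d hd
    rw [mem_cubicConstruction] at hd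
    have hq := (h₂ _).1 hu _ hd.2
    simp only [quaternaryPart, quaternary_mul_sq, quaternary_sum, quaternary_eq_zero] at hq
    rw [sum_mul_eq, h₁.sum_mul_eq_zero hx hd.1, hq.2, add_zero]
  · intro h
    constructor
    · rw [h₁]
      intro x hx
      have := h (cubicWord x 0 0) (by
        rw [mem_cubicConstruction, binaryPart_cubicWord, quaternaryPart_cubicWord]
        refine ⟨hx, ?_⟩
        convert C₂.zero_mem using 1
        funext j
        exact quaternary_zero)
      rw [sum_mul_eq, binaryPart_cubicWord] at this
      have h2 : ∀ t : ZMod 2, t + t = 0 := by decide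
      simpa [cubicWord, h2] using this
    · rw [h₂]
      -- the symplectic form vanishes against all of `C₂`
      have hs : ∀ a b : Fin l → ZMod 2, (fun j => quaternary (a j) (b j)) ∈ C₂ →
          ∑ j, ((c (1, j) + c (2, j)) * b j + (c (0, j) + c (2, j)) * a j) = 0 := by
        intro a b hab
        have := h (cubicWord 0 a b) (by
          rw [mem_cubicConstruction, binaryPart_cubicWord, quaternaryPart_cubicWord]
          exact ⟨C₁.zero_mem, hab⟩)
        rw [sum_mul_eq, binaryPart_cubicWord] at this
        have h2 : ∀ a b : ZMod 2, a + (a + b) = b ∧ b + (a + b) = a := by decide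
        simpa [cubicWord, h2] using this
      intro v hv
      obtain ⟨a, b, rfl⟩ := exists_quaternary_fun v
      simp only [quaternaryPart, quaternary_mul_sq, quaternary_sum, quaternary_eq_zero]
      refine ⟨?_, hs a b hv⟩
      -- the other component is the symplectic form against `ω v`
      have hw := C₂.smul_mem omega hv
      have he : omega • (fun j => quaternary (a j) (b j)) =
          fun j => quaternary (b j) (a j + b j) := by
        funext j
        simp [omega_eq, quaternary_mul]
      rw [he] at hw
      rw [← hs _ _ hw]
      exact sum_congr rfl fun j _ => by ring

lemma isCubic_cubicConstruction (C₁ : BinaryCode (Fin l)) (C₂ : Submodule F4 (Fin l → F4)) :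
    IsCubic (cubicConstruction C₁ C₂) := by
  intro c hc
  rw [mem_cubicConstruction] at hc ⊢
  constructor
  · convert hc.1 using 1
    funext j
    change c (0 - 1, j) + c (1 - 1, j) + c (2 - 1, j) = c (0, j) + c (1, j) + c (2, j)
    rw [show (0 - 1 : Fin 3) = 2 from rfl, show (1 - 1 : Fin 3) = 0 from rfl,
      show (2 - 1 : Fin 3) = 1 from rfl]
    ring
  · -- the shift multiplies the quaternary part by `1 + ω`
    convert C₂.smul_mem (quaternary 1 1) hc.2 using 1
    funext j
    change quaternary (c (1 - 1, j) + c (2 - 1, j)) (c (0 - 1, j) + c (2 - 1, j)) =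
      quaternary 1 1 * quaternary (c (1, j) + c (2, j)) (c (0, j) + c (2, j))
    rw [show (0 - 1 : Fin 3) = 2 from rfl, show (1 - 1 : Fin 3) = 0 from rfl,
      show (2 - 1 : Fin 3) = 1 from rfl, quaternary_mul, quaternary_inj]
    generalize c (0, j) = s, c (1, j) = t, c (2, j) = u
    revert s t u
    decide

open Classical in
/-- The weight of the word with binary part `x` and quaternary part `u`, which is
`|x| + 2 |supp x Δ supp u|`. -/
noncomputable def cubicWeight (x : Fin l → ZMod 2) (u : Fin l → F4) : ℕ :=
  ∑ j, ((if x j = 0 then 0 else 1) + 2 * if x j = 0 ↔ u j = 0 then 0 else 1)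

lemma hammingNorm_eq_cubicWeight (c : Fin 3 × Fin l → ZMod 2) :
    hammingNorm c = cubicWeight (binaryPart c) (quaternaryPart c) := by
  classical
  rw [hammingNorm_eq_sum, sum_fin_three_prod, cubicWeight]
  refine sum_congr rfl fun j _ => ?_
  simp only [binaryPart, quaternaryPart, quaternary_eq_zero]
  rcases eq_zero_or_one (c (0, j)) with h0 | h0 <;>
    rcases eq_zero_or_one (c (1, j)) with h1 | h1 <;>
    rcases eq_zero_or_one (c (2, j)) with h2 | h2 <;> simp only [h0, h1, h2] <;> rfl

lemma cubicWeight_zero_right (x : Fin l → ZMod 2) : cubicWeight x 0 = 3 * hammingNorm x := by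
  rw [cubicWeight, hammingNorm_eq_sum, mul_sum]
  refine sum_congr rfl fun j _ => ?_
  by_cases h : x j = 0 <;> simp [h]

lemma isTypeI_cubicConstruction {C₁ : BinaryCode (Fin l)} {C₂ : Submodule F4 (Fin l → F4)}
    (h₁ : IsTypeI C₁) (h₂ : IsHermitianSelfDual C₂) : IsTypeI (cubicConstruction C₁ C₂) := by
  refine ⟨isSelfDual_cubicConstruction h₁.1 h₂, ?_⟩
  obtain ⟨x, hx, hx4⟩ := h₁.2
  obtain ⟨c, hc1, hc2⟩ := exists_parts x 0
  refine ⟨c, mem_cubicConstruction.2 ⟨hc1 ▸ hx, hc2 ▸ C₂.zero_mem⟩, ?_⟩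
  rw [hammingNorm_eq_cubicWeight, hc1, hc2, cubicWeight_zero_right]
  omega

/-- The words of a Hermitian self-dual code have even weight. -/
lemma IsHermitianSelfDual.sum_support {C₂ : Submodule F4 (Fin l → F4)}
    (h₂ : IsHermitianSelfDual C₂) {a b : Fin l → ZMod 2}
    (hu : (fun j => quaternary (a j) (b j)) ∈ C₂) :
    ∑ j, (a j * a j + a j * b j + b j * b j) = 0 := by
  have h := (h₂ _).1 hu _ hu
  simp only [quaternary_mul_sq, quaternary_sum, quaternary_eq_zero] at h
  exact h.1

/-- Modulo four, the weight of a word of the cubic construction is that of its binary part. -/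
lemma four_dvd_hammingNorm_iff {C₁ : BinaryCode (Fin l)} {C₂ : Submodule F4 (Fin l → F4)}
    (h₁ : IsSelfDual C₁) (h₂ : IsHermitianSelfDual C₂) {c : Fin 3 × Fin l → ZMod 2}
    (hc : c ∈ cubicConstruction C₁ C₂) : 4 ∣ hammingNorm c ↔ 4 ∣ hammingNorm (binaryPart c) := by
  classical
  rw [mem_cubicConstruction] at hc
  have hx := (two_dvd_hammingNorm_iff _).1 (h₁.two_dvd_hammingNorm hc.1)
  have hu := h₂.sum_support hc.2
  have he : 2 ∣ ∑ j, if binaryPart c j = 0 ↔ quaternaryPart c j = 0 then 0 else 1 := by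
    rw [← ZMod.natCast_eq_zero_iff]
    refine Eq.trans ?_ ((congrArg₂ (· + ·) hx hu).trans (add_zero 0))
    rw [← sum_add_distrib, Nat.cast_sum]
    refine sum_congr rfl fun j _ => ?_
    simp only [quaternaryPart, quaternary_eq_zero]
    generalize binaryPart c j = x, c (1, j) + c (2, j) = a, c (0, j) + c (2, j) = b
    revert x a b
    decide
  rw [hammingNorm_eq_cubicWeight, cubicWeight, sum_add_distrib, ← mul_sum, ← hammingNorm_eq_sum]
  omega

/-- The word `(y | y | y)`. -/
def repeatWord (y : Fin l → ZMod 2) (p : Fin 3 × Fin l) : ZMod 2 := y p.2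

lemma sum_repeatWord_mul (y : Fin l → ZMod 2) (c : Fin 3 × Fin l → ZMod 2) :
    ∑ p, repeatWord y p * c p = ∑ j, y j * binaryPart c j := by
  rw [sum_fin_three_prod]
  exact sum_congr rfl fun j _ => by simp only [repeatWord, binaryPart]; ring

lemma binaryPart_repeatWord_add (y : Fin l → ZMod 2) (c : Fin 3 × Fin l → ZMod 2) :
    binaryPart (repeatWord y + c) = y + binaryPart c := by
  have h : ∀ y s t u : ZMod 2, y + s + (y + t) + (y + u) = y + (s + t + u) := by decide
  exact funext fun j => h _ _ _ _

lemma quaternaryPart_repeatWord_add (y : Fin l → ZMod 2) (c : Fin 3 × Fin l → ZMod 2) :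
    quaternaryPart (repeatWord y + c) = quaternaryPart c := by
  have h : ∀ y s t u : ZMod 2, y + t + (y + u) = t + u ∧ y + s + (y + u) = s + u := by decide
  exact funext fun j => quaternary_inj.2 (h _ _ _ _)

open Classical in
lemma translateCount_cubicConstruction [Fintype F4] (C₁ : BinaryCode (Fin l))
    (C₂ : Submodule F4 (Fin l → F4)) (y : Fin l → ZMod 2) (w : ℕ) :
    translateCount (cubicConstruction C₁ C₂) (repeatWord y) w =
      ∑ u ∈ univ.filter (· ∈ C₂), #(univ.filter fun x => y + x ∈ C₁ ∧ cubicWeight x u = w) := by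
  have h2 : ∀ t : ZMod 2, t + t = 0 := by decide
  have hy : y + y = 0 := funext fun j => h2 _
  rw [translateCount, ← card_sigma]
  refine card_bij' (fun c _ => ⟨quaternaryPart c, y + binaryPart c⟩)
    (fun p _ => (partsEquiv l).symm (y + p.2, p.1)) ?_ ?_ ?_ ?_
  · intro c hc
    simp only [mem_filter, mem_univ, true_and, mem_cubicConstruction, hammingNorm_eq_cubicWeight,
      binaryPart_repeatWord_add, quaternaryPart_repeatWord_add] at hc
    simp only [mem_sigma, mem_filter, mem_univ, true_and, ← add_assoc, hy, zero_add]
    tauto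
  · rintro ⟨u, x⟩ hp
    simp only [mem_sigma, mem_filter, mem_univ, true_and] at hp
    have hc := (partsEquiv l).apply_symm_apply (y + x, u)
    rw [partsEquiv_apply, Prod.mk.injEq] at hc
    simp only [mem_filter, mem_univ, true_and, mem_cubicConstruction, hammingNorm_eq_cubicWeight,
      binaryPart_repeatWord_add, quaternaryPart_repeatWord_add, hc.1, hc.2, ← add_assoc, hy,
      zero_add]
    tauto
  · intro c _
    rw [Equiv.symm_apply_eq, partsEquiv_apply, ← add_assoc, hy, zero_add]
  · rintro ⟨u, x⟩ _
    have hc := (partsEquiv l).apply_symm_apply (y + x, u)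
    rw [partsEquiv_apply, Prod.mk.injEq] at hc
    simp only [hc.1, hc.2, ← add_assoc, hy, zero_add]

end

/-! ### Binary vectors as natural numbers -/

/-- Coordinate `j` of the binary vector with bit mask `w`. -/
def coord (w j : ℕ) : ZMod 2 := bif w.testBit j then 1 else 0

lemma coord_xor (a b j : ℕ) : coord (a ^^^ b) j = coord a j + coord b j := by
  simp only [coord, Nat.testBit_xor]
  cases a.testBit j <;> cases b.testBit j <;> rfl

lemma coord_shiftRight (a n j : ℕ) : coord (a >>> n) j = coord a (n + j) := by
  simp only [coord, Nat.testBit_shiftRight]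

lemma coord_zero (j : ℕ) : coord 0 j = 0 := by simp [coord]

lemma coord_eq_coord_iff {a b i j : ℕ} : coord a i = coord b j ↔ a.testBit i = b.testBit j := by
  simp only [coord]
  cases a.testBit i <;> cases b.testBit j <;> decide

lemma beq_shiftRight_mod_two (T n : ℕ) : Nat.beq (T >>> n % 2) 1 = T.testBit n := by
  rw [Nat.testBit_eq_decide_div_mod_eq, ← Nat.shiftRight_eq_div_pow]
  rcases Nat.mod_two_eq_zero_or_one (T >>> n) with h | h <;> rw [h] <;> rfl

lemma sum_range_two_pow_succ {M : Type*} [AddCommMonoid M] (n : ℕ) (f : ℕ → M) :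
    ∑ k ∈ range (2 ^ (n + 1)), f k =
      ∑ k ∈ range (2 ^ n), f k + ∑ k ∈ range (2 ^ n), f (2 ^ n + k) := by
  rw [pow_succ, mul_two, sum_range_add]

/-! ### Trees of bit masks -/

/-- A binary tree whose leaves carry bit masks. Trees take the place of lists, since a computation
that recurses on a tree has small depth.

The functions below that take part in the computation of `isCertified_of_mem_codeTable` are given by
recursors, with Boolean conditions on numbers, because in this form they reduce fastest in the
kernel. -/
inductive MaskTree
  | nil : MaskTree
  | leaf (T : ℕ) : MaskTree
  | node (l r : MaskTree) : MaskTree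

namespace MaskTree

/-- The leaves, from left to right. -/
def toList : MaskTree → List ℕ
  | nil => []
  | leaf T => [T]
  | node l r => l.toList ++ r.toList

/-- The number of leaves. -/
noncomputable def size (t : MaskTree) : ℕ :=
  MaskTree.rec 0 (fun _ => 1) (fun _ _ a b => a + b) t

/-- The concatenation of the leaves in blocks of 22 bits, the leftmost leaf in the lowest bits. -/
noncomputable def pack (t : MaskTree) : ℕ :=
  MaskTree.rec 0 (fun T => T) (fun l _ a b => a + b <<< (22 * l.size)) t

/-- Replace each leaf by a tree. -/
noncomputable def bind (f : ℕ → MaskTree) (t : MaskTree) : MaskTree :=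
  MaskTree.rec nil f (fun _ _ a b => node a b) t

/-- The number of leaves at which the lowest bit of the block of `Z` is set. -/
noncomputable def count (t : MaskTree) : ℕ → ℕ :=
  MaskTree.rec (fun _ => 0) (fun _ Z => Z % 2)
    (fun l _ a b Z => bif Nat.beq Z 0 then 0 else
      a (Z % 2 ^ (22 * l.size)) + b (Z >>> (22 * l.size))) t

lemma length_toList (t : MaskTree) : t.toList.length = t.size := by
  induction t with
  | nil => rfl
  | leaf T => rfl
  | node l r hl hr => rw [toList, List.length_append, hl, hr]; rfl

lemma toList_bind (f : ℕ → MaskTree) (t : MaskTree) :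
    (t.bind f).toList = t.toList.flatMap fun T => (f T).toList := by
  induction t with
  | nil => rfl
  | leaf T => simp [bind, toList]
  | node l r hl hr =>
    rw [show (node l r).bind f = node (l.bind f) (r.bind f) from rfl, toList, toList, hl, hr,
      List.flatMap_append]

lemma pack_spec (t : MaskTree) (ht : ∀ T ∈ t.toList, T < 2 ^ 22) :
    t.pack < 2 ^ (22 * t.size) ∧ ∀ k T, t.toList[k]? = some T → ∀ j < 22,
      t.pack.testBit (22 * k + j) = T.testBit j := by
  induction t with
  | nil => exact ⟨Nat.one_pos, fun k T h => by simp [toList] at h⟩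
  | leaf T =>
    refine ⟨ht T (by simp [toList]), fun k T' h j _ => ?_⟩
    rw [toList, List.getElem?_singleton] at h
    split_ifs at h with hk
    · rw [hk, ← Option.some.inj h, mul_zero, zero_add]
      rfl
  | node l r hl hr =>
    rw [toList, List.forall_mem_append] at ht
    obtain ⟨hl1, hl2⟩ := hl ht.1
    obtain ⟨hr1, hr2⟩ := hr ht.2
    have hp : (node l r).pack = 2 ^ (22 * l.size) * r.pack + l.pack := by
      rw [show (node l r).pack = l.pack + r.pack <<< (22 * l.size) from rfl, Nat.shiftLeft_eq]
      ring
    have hs : (node l r).size = l.size + r.size := rfl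
    rw [hp, hs]
    constructor
    · rw [mul_add, pow_add]
      nlinarith
    · intro k T h j hj
      rw [toList] at h
      rw [Nat.testBit_two_pow_mul_add _ hl1]
      by_cases hk : k < l.size
      · rw [List.getElem?_append_left (by rwa [length_toList])] at h
        rw [if_pos (by omega), hl2 k T h j hj]
      · rw [List.getElem?_append_right (by rw [length_toList]; omega), length_toList] at h
        rw [if_neg (by omega), ← hr2 _ T h j hj]
        congr 1
        omega

lemma count_eq_countP (t : MaskTree) (p : ℕ → Bool) (Z : ℕ)
    (h : ∀ k T, t.toList[k]? = some T → Z.testBit (22 * k) = p T) :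
    t.count Z = t.toList.countP p := by
  induction t generalizing Z with
  | nil => rfl
  | leaf T =>
    have h0 := h 0 T rfl
    rw [mul_zero, Nat.testBit_zero] at h0
    rw [show (leaf T).count Z = Z % 2 from rfl, toList, List.countP_singleton, ← h0]
    rcases Nat.mod_two_eq_zero_or_one Z with hZ | hZ <;> simp [hZ]
  | node l r hl hr =>
    rw [toList] at h
    rw [show (node l r).count Z = bif Nat.beq Z 0 then 0 else
      l.count (Z % 2 ^ (22 * l.size)) + r.count (Z >>> (22 * l.size)) from rfl]
    rcases hb : Nat.beq Z 0 with _ | _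
    · rw [cond_false, hl, hr, toList, List.countP_append]
      · intro k T hk
        rw [Nat.testBit_shiftRight, ← h (l.size + k) T, mul_add]
        rw [List.getElem?_append_right (by rw [length_toList]; omega), length_toList]
        simpa using hk
      · intro k T hk
        have hk' : k < l.size := by
          rw [← length_toList]
          exact (List.getElem?_eq_some_iff.1 hk).1
        rw [Nat.testBit_mod_two_pow, ← h k T]
        · have : 22 * k < 22 * l.size := by omega
          simp [this]
        · rw [List.getElem?_append_left (by rwa [length_toList]), hk]
    · rw [cond_true, eq_comm, List.countP_eq_zero]
      intro T hT
      obtain ⟨k, hk⟩ := List.getElem?_of_mem hT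
      rw [← h k T (by simpa [toList] using hk), Nat.eq_of_beq_eq_true hb]
      simp

end MaskTree

/-! ### Syndromes of all leaves of a tree at once -/

/-- The parity checks of the vectors packed in `P` against the first `n` coordinates of `h`: the bit
at the start of each block is the inner product of the block with `h`. -/
noncomputable def parityAt (h P : ℕ) : ℕ → ℕ :=
  Nat.rec 0 fun n p => bif Nat.beq (h >>> n % 2) 1 then P >>> n ^^^ p else p

/-- The bit at the start of each block is clear iff the block satisfies every affine condition in
`H`; the condition `(h, b)` is that the inner product with `h` is `b`, and `R` has the bit at the
start of each block set. -/
noncomputable def syndromes (P R : ℕ) (H : List (ℕ × Bool)) : ℕ :=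
  List.rec 0 (fun h _ s => (bif h.2 then parityAt h.1 P 22 ^^^ R else parityAt h.1 P 22) ||| s) H

/-- The number of leaves that satisfy every affine condition in `H`. -/
noncomputable def MaskTree.hits (t : MaskTree) (H : List (ℕ × Bool)) : ℕ :=
  let R := (t.bind fun _ => .leaf 1).pack
  t.count (R ^^^ (syndromes t.pack R H &&& R))

/-- The vector `T` satisfies the affine condition `(h, b)` for every `(h, b)` in `H`. -/
def Satisfies (H : List (ℕ × Bool)) (T : ℕ) : Prop :=
  ∀ h ∈ H, ∑ j ∈ range 22, coord h.1 j * coord T j = bif h.2 then 1 else 0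

instance (H : List (ℕ × Bool)) (T : ℕ) : Decidable (Satisfies H T) := by
  unfold Satisfies
  infer_instance

lemma coord_parityAt (h P n i : ℕ) :
    coord (parityAt h P n) i = ∑ j ∈ range n, coord h j * coord P (j + i) := by
  induction n with
  | zero => exact coord_zero i
  | succ n ih =>
    rw [sum_range_succ, show parityAt h P (n + 1) = bif Nat.beq (h >>> n % 2) 1 then
      P >>> n ^^^ parityAt h P n else parityAt h P n from rfl, beq_shiftRight_mod_two]
    rcases hb : h.testBit n with _ | _
    · simp [coord, hb] at ih ⊢
      exact ih
    · rw [cond_true, coord_xor, ih, coord_shiftRight, add_comm]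
      simp [coord, hb]

lemma testBit_syndromes (P R : ℕ) (H : List (ℕ × Bool)) (i : ℕ) (hR : R.testBit i = true) :
    (syndromes P R H).testBit i = false ↔
      ∀ h ∈ H, ∑ j ∈ range 22, coord h.1 j * coord P (j + i) = bif h.2 then 1 else 0 := by
  induction H with
  | nil => simp [syndromes]
  | cons h H ih =>
    rw [show syndromes P R (h :: H) = (bif h.2 then parityAt h.1 P 22 ^^^ R else
      parityAt h.1 P 22) ||| syndromes P R H from rfl, Nat.testBit_or, Bool.or_eq_false_iff, ih,
      List.forall_mem_cons, ← coord_parityAt]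
    refine and_congr ?_ Iff.rfl
    rcases h.2 with _ | _
    · simp only [cond_false, coord]
      cases (parityAt h.1 P 22).testBit i <;> decide
    · simp only [cond_true, coord, Nat.testBit_xor, hR]
      cases (parityAt h.1 P 22).testBit i <;> decide

lemma MaskTree.hits_eq_countP (t : MaskTree) (ht : ∀ T ∈ t.toList, T < 2 ^ 22)
    (H : List (ℕ × Bool)) : t.hits H = t.toList.countP fun T => decide (Satisfies H T) := by
  refine t.count_eq_countP _ _ fun k T hk => ?_
  have hR : (t.bind fun _ => .leaf 1).pack.testBit (22 * k) = true := by
    have h1 : (t.bind fun _ => leaf 1).toList = t.toList.map fun _ => 1 := by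
      simp [toList_bind, toList, List.flatMap_def]
    refine ((t.bind fun _ => .leaf 1).pack_spec ?_).2 k 1 ?_ 0 (by norm_num)
    · simp [h1]
    · have := (List.getElem?_eq_some_iff.1 hk).1
      simp [h1, this]
  have key : (syndromes t.pack (t.bind fun _ => .leaf 1).pack H).testBit (22 * k) = false ↔
      Satisfies H T := by
    rw [testBit_syndromes _ _ _ _ hR]
    refine forall₂_congr fun h _ => ?_
    rw [sum_congr rfl fun j hj => ?_]
    rw [add_comm, coord, coord, coord, (t.pack_spec ht).2 k T hk j (mem_range.1 hj)]
  rw [Nat.testBit_xor, Nat.testBit_and, hR, Bool.and_true, Bool.true_xor, eq_comm,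
    Bool.eq_iff_iff, decide_eq_true_iff, ← key, Bool.not_eq_true']

/-! ### Vectors at a prescribed excess from a given vector -/

/-- The amount by which the weight of a word with binary part `y` exceeds the weight of the support
`T` of its quaternary part, counted over the first `n` coordinates. -/
def excess (n y T : ℕ) : ℕ :=
  ∑ j ∈ range n, bif T.testBit j then (bif y.testBit j then 0 else 1) else
    (bif y.testBit j then 3 else 0)

/-- The vectors that have excess `s` over `T` in the first `n` coordinates and agree with `T` in the
others. -/
noncomputable def near : ℕ → ℕ → ℕ → MaskTree :=
  Nat.rec (fun T s => bif Nat.beq s 0 then .leaf T else .nil)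
    fun n ih T s => bif Nat.beq s 0 then .leaf T else
      bif Nat.beq (T >>> n % 2) 1 then .node (ih T s) (ih (T - 2 ^ n) (s - 1))
      else bif Nat.ble 3 s then .node (ih T s) (ih (T + 2 ^ n) (s - 3)) else ih T s

lemma excess_congr {n y y' T T' : ℕ} (hy : ∀ j < n, y.testBit j = y'.testBit j)
    (hT : ∀ j < n, T.testBit j = T'.testBit j) : excess n y T = excess n y' T' := by
  refine sum_congr rfl fun j hj => ?_
  rw [hy j (mem_range.1 hj), hT j (mem_range.1 hj)]

/-- Only `T` itself has excess zero over `T`. -/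
lemma excess_eq_zero_iff {n y T : ℕ} : excess n y T = 0 ↔ ∀ j < n, y.testBit j = T.testBit j := by
  rw [excess, sum_eq_zero_iff]
  refine forall_congr' fun j => ?_
  rw [mem_range]
  refine imp_congr_right fun _ => ?_
  cases y.testBit j <;> cases T.testBit j <;> decide

lemma sum_excess_eq_zero (n T : ℕ) (f : ℕ → ℕ) :
    ∑ y ∈ range (2 ^ n), (if excess n y T = 0 then f (2 ^ n * (T / 2 ^ n) + y) else 0) = f T := by
  have hlt : T % 2 ^ n < 2 ^ n := Nat.mod_lt _ (by positivity)
  rw [sum_eq_single (T % 2 ^ n)]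
  · rw [if_pos, Nat.div_add_mod]
    rw [excess_eq_zero_iff]
    intro j hj
    simp [Nat.testBit_mod_two_pow, hj]
  · intro y hy hne
    rw [if_neg]
    rw [excess_eq_zero_iff]
    intro h
    refine hne (Nat.eq_of_testBit_eq fun j => ?_)
    rw [Nat.testBit_mod_two_pow]
    by_cases hj : j < n
    · simp [h j hj, hj]
    · simp only [hj, decide_false, Bool.false_and]
      exact Nat.testBit_lt_two_pow ((mem_range.1 hy).trans_le (Nat.pow_le_pow_right (by norm_num)
        (not_lt.1 hj)))
  · intro h
    exact absurd (mem_range.2 hlt) h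

lemma excess_succ_of_lt {n y T : ℕ} (hy : y < 2 ^ n) :
    excess (n + 1) y T = excess n y T + bif T.testBit n then 1 else 0 := by
  rw [excess, sum_range_succ, Nat.testBit_lt_two_pow hy]
  rfl

lemma excess_succ_two_pow_add {n y T : ℕ} (hy : y < 2 ^ n) :
    excess (n + 1) (2 ^ n + y) T = excess n y T + bif T.testBit n then 0 else 3 := by
  rw [excess, sum_range_succ, Nat.testBit_two_pow_add_eq, Nat.testBit_lt_two_pow hy]
  congr 1
  exact excess_congr (fun j hj => Nat.testBit_two_pow_add_gt hj y) fun _ _ => rfl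

lemma sum_near (n T s : ℕ) (f : ℕ → ℕ) :
    ((near n T s).toList.map f).sum =
      ∑ y ∈ range (2 ^ n), if excess n y T = s then f (2 ^ n * (T / 2 ^ n) + y) else 0 := by
  induction n generalizing T s with
  | zero =>
    rw [show near 0 T s = bif Nat.beq s 0 then .leaf T else .nil from rfl]
    rcases s with _ | s
    · simp [MaskTree.toList, excess]
    · rw [show Nat.beq (s + 1) 0 = false from rfl]
      simp [MaskTree.toList, excess]
  | succ n ih =>
    rw [show near (n + 1) T s = bif Nat.beq s 0 then .leaf T else
      bif Nat.beq (T >>> n % 2) 1 then .node (near n T s) (near n (T - 2 ^ n) (s - 1))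
      else bif Nat.ble 3 s then .node (near n T s) (near n (T + 2 ^ n) (s - 3)) else near n T s
      from rfl, beq_shiftRight_mod_two]
    rcases s with _ | s
    · rw [sum_excess_eq_zero]
      simp [MaskTree.toList]
    have hpos : 0 < 2 ^ n := by positivity
    have hdd : T / 2 ^ n / 2 = T / 2 ^ (n + 1) := by rw [Nat.div_div_eq_div_mul, pow_succ]
    rw [sum_range_two_pow_succ, show Nat.beq (s + 1) 0 = false from rfl, cond_false,
      sum_congr rfl (g := fun y => if excess n y T + (bif T.testBit n then 1 else 0) = s + 1 then
        f (2 ^ (n + 1) * (T / 2 ^ (n + 1)) + y) else 0)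
        fun y hy => by rw [excess_succ_of_lt (mem_range.1 hy)],
      sum_congr (s₁ := range (2 ^ n)) 
        (f := fun y => if excess (n + 1) (2 ^ n + y) T = s + 1 then _ else _) rfl
        (g := fun y => if excess n y T + (bif T.testBit n then 0 else 3) = s + 1 then
        f (2 ^ (n + 1) * (T / 2 ^ (n + 1)) + (2 ^ n + y)) else 0)
        fun y hy => by rw [excess_succ_two_pow_add (mem_range.1 hy)]]
    rcases hb : T.testBit n with _ | _
    · have hT : T / 2 ^ n = 2 * (T / 2 ^ (n + 1)) := by
        rw [Nat.testBit_eq_decide_div_mod_eq, decide_eq_false_iff_not] at hb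
        omega
      have hT' : (T + 2 ^ n) / 2 ^ n = 2 * (T / 2 ^ (n + 1)) + 1 := by
        rw [Nat.add_div_right _ hpos, hT]
      have hex : ∀ y, excess n y (T + 2 ^ n) = excess n y T := fun y =>
        excess_congr (fun _ _ => rfl) fun j hj => by
          rw [add_comm, Nat.testBit_two_pow_add_gt hj]
      simp only [cond_false, add_zero]
      rcases hle : Nat.ble 3 (s + 1) with _ | _
      · have hlt : s + 1 < 3 := by
          by_contra h
          rw [Nat.ble_eq_true_of_le (not_lt.1 h)] at hle
          exact absurd hle (by decide)
        rw [cond_false, ih, hT, sum_eq_zero (s := range (2 ^ n)) 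
          (f := fun y => ite (_ + 3 = _) _ _), add_zero]
        · refine sum_congr rfl fun y _ => ?_
          rw [pow_succ, mul_assoc]
        · intro y _
          rw [if_neg (by omega)]
      · have hle' := Nat.le_of_ble_eq_true hle
        rw [cond_true, MaskTree.toList, List.map_append, List.sum_append, ih, ih, hT, hT']
        congr 1
        · refine sum_congr rfl fun y _ => ?_
          rw [pow_succ, mul_assoc]
        · refine sum_congr rfl fun y _ => ?_
          rw [hex, pow_succ]
          refine if_congr (by omega) (congrArg f (by ring)) rfl
    · have hT : T / 2 ^ n = 2 * (T / 2 ^ (n + 1)) + 1 := by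
        rw [Nat.testBit_eq_decide_div_mod_eq, decide_eq_true_iff] at hb
        omega
      have hTle : 2 ^ n ≤ T := Nat.ge_two_pow_of_testBit hb
      have hT' : (T - 2 ^ n) / 2 ^ n = 2 * (T / 2 ^ (n + 1)) := by
        have := Nat.add_div_right (T - 2 ^ n) hpos
        rw [Nat.sub_add_cancel hTle] at this
        omega
      have hex : ∀ y, excess n y (T - 2 ^ n) = excess n y T := fun y =>
        excess_congr (fun _ _ => rfl) fun j hj => by
          rw [← Nat.testBit_two_pow_add_gt hj, Nat.add_sub_cancel' hTle]
      simp only [cond_true, add_zero]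
      rw [MaskTree.toList, List.map_append, List.sum_append, ih, ih, hT, hT', add_comm]
      congr 1
      · refine sum_congr rfl fun y _ => ?_
        rw [hex, pow_succ]
        refine if_congr (by omega) (congrArg f (by ring)) rfl
      · refine sum_congr rfl fun y _ => ?_
        rw [pow_succ]
        refine if_congr (by omega) (congrArg f (by ring)) rfl

lemma sum_near_of_lt {T : ℕ} (hT : T < 2 ^ 22) (s : ℕ) (f : ℕ → ℕ) :
    ((near 22 T s).toList.map f).sum =
      ∑ y ∈ range (2 ^ 22), if excess 22 y T = s then f y else 0 := by
  rw [sum_near, Nat.div_eq_of_lt hT, mul_zero]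
  simp only [zero_add]

lemma lt_of_mem_near {T s X : ℕ} (hT : T < 2 ^ 22) (hX : X ∈ (near 22 T s).toList) :
    X < 2 ^ 22 := by
  have h := sum_near_of_lt hT s fun X => if X < 2 ^ 22 then 0 else 1
  rw [sum_eq_zero fun y hy => ?_, List.sum_eq_zero_iff] at h
  · by_contra hlt
    have := h 1 (List.mem_map.2 ⟨X, hX, if_neg hlt⟩)
    exact absurd this (by norm_num)
  · rw [if_pos (mem_range.1 hy), ite_self]

/-! ### Enumerating the words of a code by bit planes -/

/-- The word of the code spanned by `rows` in which the row that is followed by `i` further rows is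
used iff bit `i` of `k` is set. -/
def word : List ℕ → ℕ → ℕ
  | [], _ => 0
  | r :: rs, k => bif k.testBit rs.length then word rs k ^^^ r else word rs k

/-- Bit `k` of this number is coordinate `j` of `word rows k`. -/
noncomputable def plane (j : ℕ) (rows : List ℕ) : ℕ :=
  List.rec 0 (fun r rs p =>
    p + ((p ^^^ (r >>> j % 2 * (2 ^ 2 ^ rs.length - 1))) <<< 2 ^ rs.length)) rows

/-- The support of the quaternary vector `a + ω b` of length 22 whose coordinates `a` and `b` are
stored in the bits `0, …, 21` and `22, …, 43` of `w`. -/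
def supportMask (w : ℕ) : ℕ := (w ||| (w >>> 22)) % 2 ^ 22

/-- Bit `k` of this number is coordinate `j` of the support of `word rows k`. -/
noncomputable def supportPlane (rows : List ℕ) (j : ℕ) : ℕ := plane j rows ||| plane (22 + j) rows

/-- Pass from the masks of the words that have weight `0, 1, …` in some coordinates to those for one
more coordinate; `d` is the mask of the words that are nonzero in it. -/
noncomputable def weightStep (d : ℕ) (es : List ℕ) : ℕ → List ℕ :=
  List.rec (fun _ => []) (fun e _ ih p => (e ^^^ ((e ^^^ p) &&& d)) :: ih e) es

/-- The masks of those words among `M` whose support has `0, …, w` elements in the first `n`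
coordinates. -/
noncomputable def weightMasks (rows : List ℕ) (M w : ℕ) : ℕ → List ℕ :=
  Nat.rec (M :: List.replicate w 0) fun n es => weightStep (supportPlane rows n) es 0

/-- The supports of the words `w + word rows k`, for the bits `k` that are set in `M`. -/
noncomputable def collect (rows : List ℕ) : ℕ → ℕ → MaskTree :=
  List.rec (fun M w => bif Nat.beq (M % 2) 0 then .nil else .leaf (supportMask w))
    (fun r rs ih M w => bif Nat.beq M 0 then .nil else
      .node (ih (M % 2 ^ 2 ^ rs.length) w) (ih (M >>> 2 ^ rs.length) (w ^^^ r))) rows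

lemma word_congr {rows : List ℕ} {k k' : ℕ}
    (h : ∀ i < rows.length, k.testBit i = k'.testBit i) : word rows k = word rows k' := by
  induction rows with
  | nil => rfl
  | cons r rs ih =>
    rw [List.length_cons] at h
    rw [word, word, h _ (Nat.lt_succ_self _), ih fun i hi => h i (hi.trans (Nat.lt_succ_self _))]

lemma word_cons_of_lt {r : ℕ} {rs : List ℕ} {k : ℕ} (hk : k < 2 ^ rs.length) :
    word (r :: rs) k = word rs k := by
  rw [word, Nat.testBit_lt_two_pow hk, cond_false]

lemma word_cons_two_pow_add {r : ℕ} {rs : List ℕ} {k : ℕ} (hk : k < 2 ^ rs.length) :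
    word (r :: rs) (2 ^ rs.length + k) = word rs k ^^^ r := by
  rw [word, Nat.testBit_two_pow_add_eq, Nat.testBit_lt_two_pow hk, Bool.not_false, cond_true,
    word_congr fun i hi => Nat.testBit_two_pow_add_gt hi k]

lemma plane_spec (j : ℕ) (rows : List ℕ) :
    plane j rows < 2 ^ 2 ^ rows.length ∧
      ∀ k < 2 ^ rows.length, (plane j rows).testBit k = (word rows k).testBit j := by
  induction rows with
  | nil => exact ⟨by simp [plane], fun k _ => by simp [plane, word]⟩
  | cons r rs ih =>
    obtain ⟨ih1, ih2⟩ := ih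
    have hp : plane j (r :: rs) = 2 ^ 2 ^ rs.length *
        (plane j rs ^^^ (r >>> j % 2 * (2 ^ 2 ^ rs.length - 1))) + plane j rs := by
      rw [show plane j (r :: rs) = plane j rs +
        ((plane j rs ^^^ (r >>> j % 2 * (2 ^ 2 ^ rs.length - 1))) <<< 2 ^ rs.length) from rfl,
        Nat.shiftLeft_eq]
      ring
    have hr : r >>> j % 2 * (2 ^ 2 ^ rs.length - 1) =
        bif r.testBit j then 2 ^ 2 ^ rs.length - 1 else 0 := by
      rw [← beq_shiftRight_mod_two]
      rcases Nat.mod_two_eq_zero_or_one (r >>> j) with h | h <;> rw [h]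
      · rw [zero_mul]; rfl
      · rw [one_mul]; rfl
    have hx : plane j rs ^^^ (r >>> j % 2 * (2 ^ 2 ^ rs.length - 1)) < 2 ^ 2 ^ rs.length := by
      refine Nat.xor_lt_two_pow ih1 ?_
      rw [hr]
      have : 0 < 2 ^ 2 ^ rs.length := by positivity
      cases r.testBit j
      · exact this
      · exact Nat.sub_lt this Nat.one_pos
    rw [hp, List.length_cons]
    have hpow : 2 ^ 2 ^ (rs.length + 1) = 2 ^ 2 ^ rs.length * 2 ^ 2 ^ rs.length := by
      rw [← pow_add, pow_succ, mul_two]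
    constructor
    · rw [hpow]
      nlinarith
    · intro k hk
      rw [Nat.testBit_two_pow_mul_add _ ih1]
      by_cases hlt : k < 2 ^ rs.length
      · rw [if_pos hlt, word_cons_of_lt hlt, ih2 k hlt]
      · obtain ⟨k', rfl⟩ := Nat.exists_eq_add_of_le (not_lt.1 hlt)
        have hk' : k' < 2 ^ rs.length := by rw [pow_succ] at hk; omega
        rw [if_neg hlt, Nat.add_sub_cancel_left, word_cons_two_pow_add hk', Nat.testBit_xor,
          Nat.testBit_xor, ih2 k' hk', hr]
        cases r.testBit j <;> simp [Nat.testBit_two_pow_sub_one, hk']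

lemma testBit_supportMask (w : ℕ) {j : ℕ} (hj : j < 22) :
    (supportMask w).testBit j = (w.testBit j || w.testBit (22 + j)) := by
  rw [supportMask, Nat.testBit_mod_two_pow, Nat.testBit_or, Nat.testBit_shiftRight]
  simp [hj]

lemma supportMask_lt (w : ℕ) : supportMask w < 2 ^ 22 := Nat.mod_lt _ (by positivity)

lemma testBit_supportPlane {rows : List ℕ} {k : ℕ} (hk : k < 2 ^ rows.length) {j : ℕ}
    (hj : j < 22) :
    (supportPlane rows j).testBit k = (supportMask (word rows k)).testBit j := by
  rw [supportPlane, Nat.testBit_or, (plane_spec _ _).2 k hk, (plane_spec _ _).2 k hk,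
    testBit_supportMask _ hj]

lemma length_weightStep (d : ℕ) (es : List ℕ) (p : ℕ) :
    (weightStep d es p).length = es.length := by
  induction es generalizing p with
  | nil => rfl
  | cons e es ih => exact congrArg (· + 1) (ih e)

lemma testBit_weightStep (d : ℕ) (es : List ℕ) (p k i : ℕ) (hi : i < es.length) :
    ((weightStep d es p).getD i 0).testBit k =
      bif d.testBit k then ((p :: es).getD i 0).testBit k else (es.getD i 0).testBit k := by
  induction es generalizing p i with
  | nil => simp at hi
  | cons e es ih =>
    rw [show weightStep d (e :: es) p = (e ^^^ ((e ^^^ p) &&& d)) :: weightStep d es e from rfl]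
    rcases i with _ | i
    · simp only [List.getD_cons_zero, Nat.testBit_xor, Nat.testBit_and]
      cases d.testBit k <;> cases e.testBit k <;> cases p.testBit k <;> rfl
    · simp only [List.getD_cons_succ]
      exact ih e i (by simpa using hi)

/-- The number of ones among the first `n` coordinates of `T`. -/
def ones (n T : ℕ) : ℕ := ∑ j ∈ range n, bif T.testBit j then 1 else 0

lemma weightMasks_spec (rows : List ℕ) (M w n : ℕ) (hn : n ≤ 22) :
    (weightMasks rows M w n).length = w + 1 ∧ ∀ k < 2 ^ rows.length, ∀ i ≤ w,
      ((weightMasks rows M w n).getD i 0).testBit k =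
        (M.testBit k && decide (ones n (supportMask (word rows k)) = i)) := by
  induction n with
  | zero =>
    refine ⟨by simp [weightMasks], fun k _ i hi => ?_⟩
    rw [show weightMasks rows M w 0 = M :: List.replicate w 0 from rfl]
    rcases i with _ | i
    · simp [ones]
    · simp [ones, List.getD_eq_getElem?_getD, List.getElem?_replicate]
      split_ifs <;> simp
  | succ n ih =>
    obtain ⟨ih1, ih2⟩ := ih (by omega)
    rw [show weightMasks rows M w (n + 1) =
      weightStep (supportPlane rows n) (weightMasks rows M w n) 0 from rfl]
    refine ⟨by rw [length_weightStep, ih1], fun k hk i hi => ?_⟩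
    rw [testBit_weightStep _ _ _ _ _ (by omega), testBit_supportPlane hk (by omega), ones,
      sum_range_succ, ← ones]
    rcases (supportMask (word rows k)).testBit n with _ | _
    · simpa using ih2 k hk i hi
    · rcases i with _ | i
      · simp
      · simpa using ih2 k hk i (by omega)

lemma sum_collect (rows : List ℕ) (M w : ℕ) (f : ℕ → ℕ) :
    ((collect rows M w).toList.map f).sum =
      ∑ k ∈ range (2 ^ rows.length),
        if M.testBit k then f (supportMask (w ^^^ word rows k)) else 0 := by
  induction rows generalizing M w with
  | nil =>
    rw [show collect [] M w = bif Nat.beq (M % 2) 0 then .nil else .leaf (supportMask w) from rfl]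
    rcases Nat.mod_two_eq_zero_or_one M with h | h <;> rw [h]
    · simp [MaskTree.toList, h]
    · rw [show Nat.beq 1 0 = false from rfl]
      simp [MaskTree.toList, word, h]
  | cons r rs ih =>
    rw [show collect (r :: rs) M w = bif Nat.beq M 0 then .nil else
      .node (collect rs (M % 2 ^ 2 ^ rs.length) w)
        (collect rs (M >>> 2 ^ rs.length) (w ^^^ r)) from rfl]
    rcases hb : Nat.beq M 0 with _ | _
    · rw [cond_false, MaskTree.toList, List.map_append, List.sum_append, ih, ih, List.length_cons,
        sum_range_two_pow_succ]
      congr 1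
      · refine sum_congr rfl fun k hk => ?_
        rw [mem_range] at hk
        rw [Nat.testBit_mod_two_pow, word_cons_of_lt hk]
        simp [hk]
      · refine sum_congr rfl fun k hk => ?_
        rw [mem_range] at hk
        rw [Nat.testBit_shiftRight, word_cons_two_pow_add hk, Nat.xor_assoc, Nat.xor_comm r]
    · rw [cond_true, Nat.eq_of_beq_eq_true hb]
      simp [MaskTree.toList]

/-! ### Words up to scalar multiples -/

/-- The binary vector of length 22 with bit mask `w`. -/
def binaryVec (w : ℕ) (j : Fin 22) : ZMod 2 := coord w j

/-- The quaternary vector `a + ω b` of length 22 whose coordinates `a` and `b` are stored in the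
bits `0, …, 21` and `22, …, 43` of `w`. -/
noncomputable def quaternaryVec (w : ℕ) (j : Fin 22) : F4 :=
  quaternary (coord w j) (coord w (22 + j))

/-- The number with bits `0, …, n - 1` from `a` and bits `n, …, 2 n - 1` from `b`. -/
def joinBits (n a b : ℕ) : ℕ := a % 2 ^ n + (b % 2 ^ n) <<< n

/-- Multiplication by `ω` on bit masks of quaternary vectors. -/
def omegaMul (w : ℕ) : ℕ := joinBits 22 (w >>> 22) (w ^^^ (w >>> 22))

/-- The generators `g` and `ω g` over `𝔽₂` of the code generated over `𝔽₄` by the vectors `g`. -/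
def binaryRows : List ℕ → List ℕ
  | [] => []
  | g :: gs => omegaMul g :: g :: binaryRows gs

lemma length_binaryRows (gs : List ℕ) : (binaryRows gs).length = 2 * gs.length := by
  induction gs with
  | nil => rfl
  | cons g gs ih => rw [binaryRows, List.length_cons, List.length_cons, ih, List.length_cons]; ring

lemma quaternaryVec_zero : quaternaryVec 0 = 0 :=
  funext fun j => by simp [quaternaryVec, coord_zero, quaternary_zero]

lemma quaternaryVec_xor (v w : ℕ) :
    quaternaryVec (v ^^^ w) = quaternaryVec v + quaternaryVec w :=
  funext fun j => by simp only [quaternaryVec, coord_xor, Pi.add_apply, quaternary_add]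

lemma testBit_joinBits {n j : ℕ} (hj : j < n) (a b : ℕ) :
    (joinBits n a b).testBit j = a.testBit j ∧
      (joinBits n a b).testBit (n + j) = b.testBit j := by
  rw [joinBits, Nat.shiftLeft_eq, mul_comm, add_comm]
  have h := Nat.testBit_two_pow_mul_add (b % 2 ^ n) (Nat.mod_lt a (Nat.two_pow_pos n))
  rw [h, h, if_pos hj, if_neg (by omega), Nat.add_sub_cancel_left, Nat.testBit_mod_two_pow,
    Nat.testBit_mod_two_pow]
  simp [hj]

lemma quaternaryVec_omegaMul (w : ℕ) : quaternaryVec (omegaMul w) = omega • quaternaryVec w := by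
  funext j
  have h := testBit_joinBits j.isLt (w >>> 22) (w ^^^ (w >>> 22))
  have h1' : coord (omegaMul w) j = coord w (22 + j) := by
    rw [coord, omegaMul, h.1, Nat.testBit_shiftRight, coord]
  have h2' : coord (omegaMul w) (22 + j) = coord w j + coord w (22 + j) := by
    rw [← coord_shiftRight w, ← coord_xor, coord, omegaMul, h.2, coord]
  simp only [quaternaryVec, Pi.smul_apply, smul_eq_mul, h1', h2']
  rw [omega_eq, quaternary_mul]
  simp

section
variable {V : Type*} [AddCommGroup V] [Module F4 V]

/-- The sum of `f` over all linear combinations of the given vectors with coefficients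
`0, 1, ω, ω + 1`. -/
noncomputable def combSum : List V → (V → ℕ) → ℕ
  | [], f => f 0
  | g :: gs, f => combSum gs f + combSum gs (fun v => f (v + g)) +
      (combSum gs (fun v => f (v + omega • g)) + combSum gs (fun v => f (v + g + omega • g)))

/-- The sum of `f` over the nonzero linear combinations whose first nonzero coefficient is one. -/
noncomputable def normalSum : List V → (V → ℕ) → ℕ
  | [], _ => 0
  | g :: gs, f => normalSum gs f + combSum gs (fun v => f (v + g))

lemma combSum_omega_smul (gs : List V) (f : V → ℕ) :
    combSum gs (fun v => f (omega • v)) = combSum gs f := by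
  induction gs generalizing f with
  | nil => simp [combSum]
  | cons g gs ih =>
    have h : ∀ v : V, v + omega • g + omega • omega • g = v + g := by
      intro v
      rw [smul_smul, omega_mul_omega, add_smul, one_smul]
      have : omega • g + omega • g = 0 := by
        rw [← two_smul F4, F4_two, zero_smul]
      calc v + omega • g + (omega • g + g) = v + (omega • g + omega • g) + g := by abel
        _ = v + g := by rw [this, add_zero]
    have h' : ∀ v : V, v + omega • omega • g = v + g + omega • g := by
      intro v
      rw [smul_smul, omega_mul_omega, add_smul, one_smul]
      abel
    simp only [combSum, smul_add]
    rw [ih f, ih fun v => f (v + omega • g), ih fun v => f (v + omega • omega • g),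
      ih fun v => f (v + omega • g + omega • omega • g)]
    simp only [h, h']
    ring

/-- A function that is invariant under scalar multiplication may be summed over normalized
combinations, since each of them has exactly three nonzero multiples. -/
lemma combSum_eq (gs : List V) {f : V → ℕ} (hf : ∀ v, f (omega • v) = f v) :
    combSum gs f = f 0 + 3 * normalSum gs f := by
  induction gs with
  | nil => rfl
  | cons g gs ih =>
    have h1 : combSum gs (fun v => f (v + omega • g)) = combSum gs fun v => f (v + g) := by
      rw [← combSum_omega_smul]
      simp only [← smul_add, hf]
    have h2 : combSum gs (fun v => f (v + g + omega • g)) = combSum gs fun v => f (v + g) := by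
      have h : ∀ v : V, omega • omega • (v + g) = omega • omega • v + g + omega • g := by
        intro v
        rw [smul_add, smul_add, smul_smul omega omega g, omega_mul_omega, add_smul, one_smul]
        abel
      rw [← combSum_omega_smul gs fun v => f (v + g + omega • g),
        ← combSum_omega_smul gs fun v => f (omega • v + g + omega • g)]
      simp only [← h, hf]
    rw [combSum, normalSum, h1, h2, ih]
    ring
end

/-- The mask of the numbers `k < 4 ^ n` whose highest nonzero base-four digit is one. -/
noncomputable def normalMask : ℕ → ℕ := Nat.rec 0 fun n m => m + (2 ^ 4 ^ n - 1) <<< 4 ^ n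

lemma normalMask_spec (n : ℕ) : normalMask n < 2 ^ 4 ^ n ∧
    ∀ k, (normalMask (n + 1)).testBit k =
      if k < 4 ^ n then (normalMask n).testBit k else decide (k - 4 ^ n < 4 ^ n) := by
  have h : ∀ n, normalMask (n + 1) = 2 ^ 4 ^ n * (2 ^ 4 ^ n - 1) + normalMask n := by
    intro n
    rw [show normalMask (n + 1) = normalMask n + (2 ^ 4 ^ n - 1) <<< 4 ^ n from rfl,
      Nat.shiftLeft_eq]
    ring
  have hlt : normalMask n < 2 ^ 4 ^ n := by
    induction n with
    | zero => exact Nat.two_pos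
    | succ n ih =>
      rw [h]
      calc _ < 2 ^ 4 ^ n * (2 ^ 4 ^ n - 1) + 2 ^ 4 ^ n := by omega
        _ = 2 ^ 4 ^ n * 2 ^ 4 ^ n := by
          rw [← Nat.mul_succ, Nat.succ_eq_add_one, Nat.sub_add_cancel (Nat.one_le_two_pow)]
        _ = 2 ^ (4 ^ n + 4 ^ n) := (pow_add _ _ _).symm
        _ ≤ _ := Nat.pow_le_pow_right (by norm_num) (by rw [pow_succ]; omega)
  refine ⟨hlt, fun k => ?_⟩
  rw [h, Nat.testBit_two_pow_mul_add _ hlt, Nat.testBit_two_pow_sub_one]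

lemma sum_word_cons (r : ℕ) (rs : List ℕ) (p : ℕ → Prop) [DecidablePred p]
    (f : (Fin 22 → F4) → ℕ) :
    ∑ k ∈ range (2 ^ (r :: rs).length), (if p k then f (quaternaryVec (word (r :: rs) k)) else 0) =
      ∑ k ∈ range (2 ^ rs.length), (if p k then f (quaternaryVec (word rs k)) else 0) +
      ∑ k ∈ range (2 ^ rs.length), (if p (2 ^ rs.length + k) then
        f (quaternaryVec (word rs k) + quaternaryVec r) else 0) := by
  rw [List.length_cons, sum_range_two_pow_succ]
  congr 1
  · exact sum_congr rfl fun k hk => by rw [word_cons_of_lt (mem_range.1 hk)]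
  · exact sum_congr rfl fun k hk => by
      rw [word_cons_two_pow_add (mem_range.1 hk), quaternaryVec_xor]

lemma sum_word_binaryRows (gs : List ℕ) (f : (Fin 22 → F4) → ℕ) :
    ∑ k ∈ range (2 ^ (binaryRows gs).length), f (quaternaryVec (word (binaryRows gs) k)) =
      combSum (gs.map quaternaryVec) f := by
  induction gs generalizing f with
  | nil => simp [binaryRows, word, combSum, quaternaryVec_zero]
  | cons g gs ih =>
    have h : ∀ (r : ℕ) (rs : List ℕ) (f : (Fin 22 → F4) → ℕ),
        ∑ k ∈ range (2 ^ (r :: rs).length), f (quaternaryVec (word (r :: rs) k)) =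
        ∑ k ∈ range (2 ^ rs.length), f (quaternaryVec (word rs k)) +
        ∑ k ∈ range (2 ^ rs.length), f (quaternaryVec (word rs k) + quaternaryVec r) := by
      intro r rs f
      simpa only [if_true] using sum_word_cons r rs (fun _ => True) f
    rw [binaryRows, h, h, h g _ fun v => f (v + quaternaryVec (omegaMul g)), ih,
      ih fun v => f (v + quaternaryVec g),
      ih fun v => f (v + quaternaryVec (omegaMul g)),
      ih fun v => f (v + quaternaryVec g + quaternaryVec (omegaMul g)), quaternaryVec_omegaMul,
      List.map_cons, combSum]

lemma sum_normalMask (gs : List ℕ) (f : (Fin 22 → F4) → ℕ) :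
    ∑ k ∈ range (2 ^ (binaryRows gs).length), (if (normalMask gs.length).testBit k then
        f (quaternaryVec (word (binaryRows gs) k)) else 0) =
      normalSum (gs.map quaternaryVec) f := by
  induction gs with
  | nil => simp [binaryRows, normalSum, normalMask]
  | cons g gs ih =>
    have h4 : 2 ^ (binaryRows gs).length = 4 ^ gs.length := by
      rw [length_binaryRows, pow_mul]
      norm_num
    have h1 : ∀ k ∈ range (2 ^ (binaryRows gs).length),
        (normalMask (gs.length + 1)).testBit k = (normalMask gs.length).testBit k := fun k hk => by
      rw [(normalMask_spec gs.length).2, if_pos (h4 ▸ mem_range.1 hk)]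
    have h2 : ∀ k ∈ range (2 ^ (binaryRows gs).length),
        (normalMask (gs.length + 1)).testBit (2 ^ (binaryRows gs).length + k) = true :=
      fun k hk => by
        rw [mem_range, h4] at hk
        rw [(normalMask_spec gs.length).2, h4, if_neg (by omega), decide_eq_true_iff]
        omega
    have h3 : ∀ k, (normalMask (gs.length + 1)).testBit (2 ^ (g :: binaryRows gs).length + k) =
        false := fun k => by
      rw [(normalMask_spec gs.length).2, List.length_cons, pow_succ, h4, if_neg (by omega),
        decide_eq_false_iff_not]
      omega
    rw [List.map_cons, normalSum, ← ih, ← sum_word_binaryRows, binaryRows,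
      show (g :: gs).length = gs.length + 1 from rfl,
      sum_word_cons _ _ (fun k => (normalMask (gs.length + 1)).testBit k = true),
      sum_word_cons _ _ (fun k => (normalMask (gs.length + 1)).testBit k = true)]
    simp only [h3, Bool.false_eq_true, if_false, sum_const_zero, add_zero]
    congr 1
    · exact sum_congr rfl fun k hk => by rw [h1 k hk]
    · exact sum_congr rfl fun k hk => by rw [h2 k hk, if_pos rfl]

/-! ### Counting the solutions of given weight -/

/-- The supports of the words of weight `0, …, 10` of the quaternary code generated by `gens`, one
out of three proportional words each; the zero word is left out. -/
noncomputable def lightTrees (gens : List ℕ) : List MaskTree :=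
  (weightMasks (binaryRows gens) (normalMask gens.length) 10 22).map fun M =>
    collect (binaryRows gens) M 0

/-- The binary parts of the words of weight `w` whose quaternary part has its support in one of the
trees; the supports in tree `i` have `i` elements. -/
noncomputable def binaryParts (trees : List MaskTree) : ℕ → MaskTree :=
  List.rec (fun _ => .nil) (fun L _ ih w =>
    .node (L.bind fun T => near 22 T w) (bif Nat.beq w 0 then .nil else ih (w - 1))) trees

/-- The number of solutions `x` of the system `H` for which the word with binary part `x` and
quaternary part `v` has weight `w`. -/
noncomputable def solutionCount (H : List (ℕ × Bool)) (w : ℕ) (v : Fin 22 → F4) : ℕ :=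
  open Classical in
  #{x : Fin 22 → ZMod 2 | (∀ h ∈ H, ∑ j : Fin 22, coord h.1 j * x j = bif h.2 then 1 else 0) ∧
    cubicWeight x v = w}

lemma sum_coord (n : ℕ) (F : (Fin n → ZMod 2) → ℕ) :
    ∑ y ∈ range (2 ^ n), F (fun j => coord y j) = ∑ x, F x := by
  rw [← Fin.sum_univ_eq_sum_range fun y => F fun j => coord y j]
  refine Function.Bijective.sum_comp (g := F) 
    (e := fun y : Fin (2 ^ n) => fun j : Fin n => coord y j) ?_
  rw [Fintype.bijective_iff_injective_and_card]
  refine ⟨fun y z h => Fin.ext (Nat.eq_of_testBit_eq fun j => ?_), by simp⟩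
  by_cases hj : j < n
  · exact coord_eq_coord_iff.1 (congrFun h ⟨j, hj⟩)
  · have hle : 2 ^ n ≤ 2 ^ j := Nat.pow_le_pow_right two_pos (not_lt.1 hj)
    rw [Nat.testBit_lt_two_pow (y.isLt.trans_le hle), Nat.testBit_lt_two_pow (z.isLt.trans_le hle)]

lemma ones_add_excess (y w : ℕ) :
    ones 22 (supportMask w) + excess 22 y (supportMask w) =
      cubicWeight (binaryVec y) (quaternaryVec w) := by
  rw [ones, excess, ← sum_add_distrib, cubicWeight, ← Fin.sum_univ_eq_sum_range fun j =>
    (bif (supportMask w).testBit j then 1 else 0) + bif (supportMask w).testBit j then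
      (bif y.testBit j then 0 else 1) else (bif y.testBit j then 3 else 0)]
  refine sum_congr rfl fun j _ => ?_
  have h : quaternaryVec w j = 0 ↔ (supportMask w).testBit j = false := by
    rw [quaternaryVec, quaternary_eq_zero, testBit_supportMask w j.isLt, coord, coord]
    cases w.testBit j <;> cases w.testBit (22 + j) <;> decide
  have h' : binaryVec y j = 0 ↔ y.testBit j = false := by
    rw [binaryVec, coord]
    cases y.testBit j <;> decide
  simp only [h, h']
  cases (supportMask w).testBit j <;> cases y.testBit j <;> simp

lemma solutionCount_eq_sum (H : List (ℕ × Bool)) (w k : ℕ) :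
    solutionCount H w (quaternaryVec k) = ∑ y ∈ range (2 ^ 22),
      if ones 22 (supportMask k) + excess 22 y (supportMask k) = w then
        (if Satisfies H y then 1 else 0) else 0 := by
  classical
  rw [solutionCount, card_filter, ← sum_coord]
  refine sum_congr rfl fun y _ => ?_
  rw [ones_add_excess, ← ite_and]
  refine if_congr (and_comm.trans (and_congr Iff.rfl (forall₂_congr fun h _ => ?_))) rfl rfl
  rw [← Fin.sum_univ_eq_sum_range fun j => coord h.1 j * coord y j]

lemma solutionCount_omega_smul (H : List (ℕ × Bool)) (w : ℕ) (v : Fin 22 → F4) :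
    solutionCount H w (omega • v) = solutionCount H w v := by
  have h0 : ∀ z, omega * z = 0 ↔ z = 0 := fun z => by
    obtain ⟨a, b, rfl⟩ := exists_quaternary z
    rw [omega_eq, quaternary_mul, quaternary_eq_zero, quaternary_eq_zero]
    revert a b
    decide
  have h : ∀ x, cubicWeight x (omega • v) = cubicWeight x v := fun x => by
    simp only [cubicWeight, Pi.smul_apply, smul_eq_mul, h0]
  simp only [solutionCount, h]

lemma forall_of_sum_map_eq_zero {l : List ℕ} {p : ℕ → Prop} [DecidablePred p]
    (h : (l.map fun X => if p X then 0 else 1).sum = 0) : ∀ X ∈ l, p X := by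
  intro X hX
  by_contra hp
  have := List.sum_eq_zero_iff.1 h 1 (List.mem_map.2 ⟨X, hX, if_neg hp⟩)
  exact absurd this (by norm_num)

lemma hits_eq_sum (t : MaskTree) (ht : ∀ T ∈ t.toList, T < 2 ^ 22) (H : List (ℕ × Bool)) :
    t.hits H = (t.toList.map fun T => if Satisfies H T then 1 else 0).sum := by
  rw [t.hits_eq_countP ht]
  induction t.toList with
  | nil => rfl
  | cons a l ih => rw [List.countP_cons, ih, List.map_cons, List.sum_cons, add_comm]; simp

lemma sum_flatMap (l : List ℕ) (g : ℕ → List ℕ) (f : ℕ → ℕ) :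
    ((l.flatMap g).map f).sum = (l.map fun T => ((g T).map f).sum).sum := by
  induction l with
  | nil => rfl
  | cons a l ih => rw [List.flatMap_cons, List.map_append, List.sum_append, ih, List.map_cons,
      List.sum_cons]

lemma sum_binaryParts (trees : List MaskTree) (ht : ∀ t ∈ trees, ∀ T ∈ t.toList, T < 2 ^ 22)
    (w : ℕ) (f : ℕ → ℕ) :
    ((binaryParts trees w).toList.map f).sum = ∑ i ∈ range (w + 1),
      ((trees.getD i .nil).toList.map fun T =>
        ∑ y ∈ range (2 ^ 22), if i + excess 22 y T = w then f y else 0).sum := by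
  induction trees generalizing w with
  | nil => simp [binaryParts, MaskTree.toList]
  | cons t trees ih =>
    rw [List.forall_mem_cons] at ht
    rw [show binaryParts (t :: trees) w = .node (t.bind fun T => near 22 T w)
      (bif Nat.beq w 0 then .nil else binaryParts trees (w - 1)) from rfl, MaskTree.toList,
      List.map_append, List.sum_append, MaskTree.toList_bind, sum_flatMap, sum_range_succ',
      add_comm]
    refine congrArg₂ (· + ·) ?_ ?_
    · rcases w with _ | w
      · rw [sum_range_zero]
        exact List.sum_nil
      · rw [show (bif Nat.beq (w + 1) 0 then MaskTree.nil else binaryParts trees (w + 1 - 1)) =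
          binaryParts trees w from rfl, ih ht.2]
        refine sum_congr rfl fun i _ => ?_
        rw [List.getD_cons_succ]
        refine congrArg List.sum (List.map_congr_left fun T _ => sum_congr rfl fun y _ => ?_)
        exact if_congr (by omega) rfl rfl
    · rw [List.getD_cons_zero]
      refine congrArg List.sum (List.map_congr_left fun T hT => ?_)
      rw [sum_near_of_lt (ht.1 T hT)]
      simp only [zero_add]

lemma lt_of_mem_lightTrees {gens : List ℕ} : ∀ t ∈ lightTrees gens, ∀ T ∈ t.toList, T < 2 ^ 22 := by
  intro t ht
  obtain ⟨M, -, rfl⟩ := List.mem_map.1 ht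
  refine forall_of_sum_map_eq_zero ?_
  rw [sum_collect]
  refine sum_eq_zero fun k _ => ?_
  rw [if_pos (supportMask_lt _), ite_self]

lemma sum_binaryParts_lightTrees (gens : List ℕ) {w : ℕ} (hw : w ≤ 10) (f : ℕ → ℕ) :
    ((binaryParts (lightTrees gens) w).toList.map f).sum =
      ∑ k ∈ range (2 ^ (binaryRows gens).length), if (normalMask gens.length).testBit k then
        ∑ y ∈ range (2 ^ 22), if ones 22 (supportMask (word (binaryRows gens) k)) +
          excess 22 y (supportMask (word (binaryRows gens) k)) = w then f y else 0 else 0 := by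
  obtain ⟨hl, hm⟩ := weightMasks_spec (binaryRows gens) (normalMask gens.length) 10 22 le_rfl
  rw [sum_binaryParts _ lt_of_mem_lightTrees]
  have h : ∀ i ∈ range (w + 1), (((lightTrees gens).getD i .nil).toList.map fun T =>
        ∑ y ∈ range (2 ^ 22), if i + excess 22 y T = w then f y else 0).sum =
      ∑ k ∈ range (2 ^ (binaryRows gens).length), if (normalMask gens.length).testBit k then
        (if ones 22 (supportMask (word (binaryRows gens) k)) = i then
        ∑ y ∈ range (2 ^ 22), if i +
          excess 22 y (supportMask (word (binaryRows gens) k)) = w then f y else 0 else 0)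
        else 0 := by
    intro i hi
    rw [mem_range] at hi
    have hi' : i < (weightMasks (binaryRows gens) (normalMask gens.length) 10 22).length := by omega
    rw [show (lightTrees gens).getD i .nil = collect (binaryRows gens)
      ((weightMasks (binaryRows gens) (normalMask gens.length) 10 22).getD i 0) 0 by
        simp [lightTrees, List.getD_eq_getElem?_getD, hi'], sum_collect]
    refine sum_congr rfl fun k hk => ?_
    rw [hm k (mem_range.1 hk) i (by omega), Nat.zero_xor, ← ite_and]
    exact if_congr (by simp) rfl rfl
  rw [sum_congr rfl h, sum_comm]
  refine sum_congr rfl fun k _ => ?_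
  split_ifs with hk
  · rw [sum_ite_eq]
    split_ifs with h1
    · rfl
    · rw [mem_range] at h1
      exact (sum_eq_zero fun y _ => if_neg (by omega)).symm
  · exact sum_const_zero

/-- The two searches together count the solutions over all words of the quaternary code: the first
is for the zero word, the second for one out of three proportional nonzero words. -/
lemma hits_add_hits (gens : List ℕ) (H : List (ℕ × Bool)) {w : ℕ} (hw : w ≤ 10) :
    (near 22 0 w).hits H + 3 * (binaryParts (lightTrees gens) w).hits H =
      combSum (gens.map quaternaryVec) (solutionCount H w) := by
  rw [combSum_eq _ (solutionCount_omega_smul H w),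
    hits_eq_sum _ fun X => lt_of_mem_near (by norm_num), hits_eq_sum,
    sum_near_of_lt (by norm_num), sum_binaryParts_lightTrees gens hw,
    ← quaternaryVec_zero, solutionCount_eq_sum, ← sum_normalMask]
  · refine congrArg₂ (· + ·) ?_ ?_
    · refine sum_congr rfl fun y _ => ?_
      rw [show supportMask 0 = 0 from rfl, show ones 22 0 = 0 by simp [ones], zero_add]
    · refine congrArg (3 * ·) (sum_congr rfl fun k _ => ?_)
      rw [solutionCount_eq_sum]
  · refine forall_of_sum_map_eq_zero ?_
    rw [sum_binaryParts_lightTrees gens hw]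
    refine sum_eq_zero fun k _ => ?_
    rw [sum_eq_zero fun y hy => ?_, ite_self]
    rw [if_pos (mem_range.1 hy), ite_self]

/-! ### Systematic self-orthogonal codes -/

section
variable {n : ℕ}

lemma sum_mul_coeff_of_systematic {K : Type*} [CommRing K] {g : Fin n → Fin (n + n) → K}
    (hI : ∀ i j, g i (Fin.castAdd n j) = if i = j then 1 else 0) (m : Fin n → K) (j : Fin n) :
    (∑ i, m i • g i) (Fin.castAdd n j) = m j := by
  simp [Finset.sum_apply, hI]

/-- A code with a systematic generator matrix `(1 | B)` that is self-orthogonal with respect to a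
sesquilinear form is self-dual: the matrix `B` satisfies `B * σ(B)ᵀ = -1`, hence also
`σ(B)ᵀ * B = -1`. -/
lemma mem_span_iff_of_systematic {K : Type*} [CommRing K] (σ : K →+* K)
    {g : Fin n → Fin (n + n) → K} (hI : ∀ i j, g i (Fin.castAdd n j) = if i = j then 1 else 0)
    (ho : ∀ i i', ∑ j, g i j * σ (g i' j) = 0) (u : Fin (n + n) → K) :
    u ∈ Submodule.span K (Set.range g) ↔ ∀ i, ∑ j, u j * σ (g i j) = 0 := by
  constructor
  · intro hu i
    induction hu using Submodule.span_induction with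
    | mem x hx =>
      obtain ⟨i', rfl⟩ := hx
      exact ho i' i
    | zero => simp
    | add x y _ _ hx hy => simp [add_mul, sum_add_distrib, hx, hy]
    | smul c x _ hx => simp [mul_assoc, ← mul_sum, hx]
  · intro hu
    let B : Matrix (Fin n) (Fin n) K := fun i j => g i (Fin.natAdd n j)
    let B' : Matrix (Fin n) (Fin n) K := fun j i => σ (g i (Fin.natAdd n j))
    have hB : B * -B' = 1 := by
      ext i i'
      have h := ho i i'
      rw [Fin.sum_univ_add] at h
      simp only [hI, apply_ite σ, map_one, map_zero, ite_mul, one_mul, zero_mul] at h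
      rw [sum_ite_eq, if_pos (mem_univ _)] at h
      rw [Matrix.mul_neg, Matrix.neg_apply, Matrix.mul_apply, Matrix.one_apply,
        ← eq_neg_of_add_eq_zero_left h]
      exact if_congr eq_comm rfl rfl
    have hB' : -B' * B = 1 := mul_eq_one_comm.1 hB
    rw [Submodule.mem_span_range_iff_exists_fun]
    refine ⟨fun i => u (Fin.castAdd n i), ?_⟩
    funext j
    refine Fin.addCases (fun j => sum_mul_coeff_of_systematic hI _ j) (fun j => ?_) j
    have h1 : ∀ i, u (Fin.castAdd n i) = Matrix.vecMul (fun j => u (Fin.natAdd n j)) (-B') i := by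
      intro i
      have h := hu i
      rw [Fin.sum_univ_add] at h
      simp only [hI, apply_ite σ, map_one, map_zero, mul_ite, mul_one, mul_zero] at h
      rw [sum_ite_eq, if_pos (mem_univ _)] at h
      rw [eq_neg_of_add_eq_zero_left h, Matrix.vecMul_neg]
      rfl
    have h2 := congrFun (Matrix.vecMul_vecMul (fun j => u (Fin.natAdd n j)) (-B') B) j
    rw [hB', Matrix.vecMul_one, ← funext h1] at h2
    rw [← h2, Finset.sum_apply]
    rfl

lemma mem_span_iff_forall_mem_of_systematic {K : Type*} [CommRing K] (σ : K →+* K)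
    {g : Fin n → Fin (n + n) → K} (hI : ∀ i j, g i (Fin.castAdd n j) = if i = j then 1 else 0)
    (ho : ∀ i i', ∑ j, g i j * σ (g i' j) = 0) (u : Fin (n + n) → K) :
    u ∈ Submodule.span K (Set.range g) ↔
      ∀ v ∈ Submodule.span K (Set.range g), ∑ j, u j * σ (v j) = 0 := by
  rw [mem_span_iff_of_systematic σ hI ho]
  refine ⟨fun h v hv => ?_, fun h i => h _ (Submodule.subset_span ⟨i, rfl⟩)⟩
  induction hv using Submodule.span_induction with
  | mem x hx =>
    obtain ⟨i, rfl⟩ := hx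
    exact h i
  | zero => simp
  | add x y _ _ hx hy => simp [mul_add, sum_add_distrib, hx, hy]
  | smul c x _ hx =>
    simp only [Pi.smul_apply, smul_eq_mul, map_mul, mul_left_comm _ (σ c), ← mul_sum, hx, mul_zero]

end

/-! ### Summation over a quaternary code -/

noncomputable instance : Fintype F4 := Fintype.ofBijective _ quaternary_bijective

lemma sum_F4 {M : Type*} [AddCommMonoid M] (f : F4 → M) :
    ∑ z, f z = f 0 + f 1 + (f omega + f (1 + omega)) := by
  rw [← quaternary_bijective.sum_comp, Fintype.sum_prod_type]
  have h : (univ : Finset (ZMod 2)) = {0, 1} := rfl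
  have h1 : quaternary 1 0 = 1 := by simp [quaternary]
  have h2 : quaternary 1 1 = 1 + omega := by simp [quaternary]
  simp [h, quaternary_zero, ← omega_eq, h1, h2]
  abel

lemma sum_messages {V : Type*} [AddCommGroup V] [Module F4 V] (n : ℕ) (g : Fin n → V) (f : V → ℕ) :
    ∑ m : Fin n → F4, f (∑ i, m i • g i) = combSum (List.ofFn g) f := by
  induction n generalizing f with
  | zero => simp [combSum]
  | succ n ih =>
    rw [← (Fin.consEquiv fun _ => F4).sum_comp, Fintype.sum_prod_type, sum_F4, List.ofFn_succ,
      combSum, ← ih, ← ih, ← ih, ← ih]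
    simp only [Fin.consEquiv_apply, Fin.sum_univ_succ, Fin.cons_zero, Fin.cons_succ, zero_smul,
      zero_add, one_smul, add_smul]
    refine congrArg₂ (· + ·) (congrArg₂ (· + ·) rfl ?_) (congrArg₂ (· + ·) ?_ ?_) <;>
      refine sum_congr rfl fun m _ => congrArg f ?_ <;> abel

open Classical in
lemma sum_span_of_systematic {n : ℕ} {g : Fin n → Fin (n + n) → F4}
    (hI : ∀ i j, g i (Fin.castAdd n j) = if i = j then 1 else 0) (f : (Fin (n + n) → F4) → ℕ) :
    ∑ u ∈ univ.filter (· ∈ Submodule.span F4 (Set.range g)), f u = combSum (List.ofFn g) f := by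
  rw [← sum_messages]
  refine (sum_bij (fun m _ => ∑ i, m i • g i) ?_ ?_ ?_ fun _ _ => rfl).symm
  · intro m _
    rw [mem_filter, Submodule.mem_span_range_iff_exists_fun]
    exact ⟨mem_univ _, m, rfl⟩
  · intro m _ m' _ h
    funext j
    rw [← sum_mul_coeff_of_systematic hI m j, h, sum_mul_coeff_of_systematic hI]
  · intro u hu
    rw [mem_filter, Submodule.mem_span_range_iff_exists_fun] at hu
    obtain ⟨m, rfl⟩ := hu.2
    exact ⟨m, mem_univ _, rfl⟩

/-! ### Cubic codes from a fixed quaternary code -/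

/-- The rows of a systematic generator matrix of a Hermitian self-dual code of length 22. The bits
`0, …, 21` of a row are the components `a` of its coordinates `a + ω b`, the bits `22, …, 43` the
components `b`. -/
def quaternaryRows : List ℕ :=
  [1580550705153, 17042433155074, 6743100934148, 6133214771208, 3547643777040, 3401616048160,
   2826091051072, 4836136910976, 4372277424384, 15066745500160, 17179871923200]

lemma quaternaryRows_systematic : ∀ i j : Fin 11,
    coord (quaternaryRows.getD i 0) j = (if i = j then 1 else 0) ∧
      coord (quaternaryRows.getD i 0) (22 + j) = 0 := by decide +kernel

lemma quaternaryRows_orthogonal : ∀ i i' : Fin 11,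
    (∑ j : Fin 22, (coord (quaternaryRows.getD i 0) j * coord (quaternaryRows.getD i' 0) j +
      coord (quaternaryRows.getD i 0) j * coord (quaternaryRows.getD i' 0) (22 + j) +
      coord (quaternaryRows.getD i 0) (22 + j) * coord (quaternaryRows.getD i' 0) (22 + j)) = 0) ∧
    ∑ j : Fin 22, (coord (quaternaryRows.getD i 0) j * coord (quaternaryRows.getD i' 0) (22 + j) +
      coord (quaternaryRows.getD i 0) (22 + j) * coord (quaternaryRows.getD i' 0) j) = 0 := by
  decide +kernel

/-- The Hermitian self-dual code generated by `quaternaryRows`. -/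
noncomputable def quaternaryCode : Submodule F4 (Fin 22 → F4) :=
  Submodule.span F4 (Set.range fun i : Fin 11 => quaternaryVec (quaternaryRows.getD i 0))

lemma quaternaryVec_castAdd (i j : Fin 11) :
    quaternaryVec (quaternaryRows.getD i 0) (Fin.castAdd 11 j) = if i = j then 1 else 0 := by
  obtain ⟨h1, h2⟩ := quaternaryRows_systematic i j
  rw [quaternaryVec, Fin.val_castAdd, h1, h2]
  split_ifs <;> simp [quaternary]

lemma isHermitianSelfDual_quaternaryCode : IsHermitianSelfDual quaternaryCode := by
  have : CharP F4 2 := CharTwo.of_one_ne_zero_of_two_eq_zero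
    (by
      rw [show (1 : F4) = quaternary 1 0 by simp [quaternary], Ne, quaternary_eq_zero]
      decide) F4_two
  exact mem_span_iff_forall_mem_of_systematic (n := 11) (frobenius F4 2) quaternaryVec_castAdd
    fun i i' => by
      simp only [frobenius_def, quaternaryVec, quaternary_mul_sq, quaternary_sum]
      exact quaternary_eq_zero.2 (quaternaryRows_orthogonal i i')

open Classical in
lemma sum_quaternaryCode (f : (Fin 22 → F4) → ℕ) :
    ∑ u ∈ univ.filter (· ∈ quaternaryCode), f u =
      combSum (quaternaryRows.map quaternaryVec) f := by
  have h := sum_span_of_systematic (n := 11) quaternaryVec_castAdd f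
  exact h

/-- The affine conditions `h · x = s h` for the rows `h`. -/
def systemOf (rows : List ℕ) (s : ℕ → Bool) : List (ℕ × Bool) := rows.map fun h => (h, s h)

/-- Whether the weight of the row `h` is not divisible by four. -/
def isSinglyEven (h : ℕ) : Bool := !Nat.beq (ones 22 h % 4) 0

/-- The number of words of weight `w` in the translate of a cubic code by a word `(y | y | y)`,
where the inner products of `y` with the rows of the binary component are given by `s`; see
`IsSystematic.translateCount_eq_wordCount`. -/
noncomputable def wordCount (rows : List ℕ) (s : ℕ → Bool) (w : ℕ) : ℕ :=
  (near 22 0 w).hits (systemOf rows s) +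
    3 * (binaryParts (lightTrees quaternaryRows) w).hits (systemOf rows s)

/-- The binary code generated by `rows`. -/
def binaryCode (rows : List ℕ) : BinaryCode (Fin 22) :=
  Submodule.span (ZMod 2) (Set.range fun i : Fin 11 => binaryVec (rows.getD i 0))

/-- The tree with the given leaves. -/
def MaskTree.ofList (l : List ℕ) : MaskTree := l.foldr (fun T t => .node (.leaf T) t) .nil

lemma MaskTree.toList_ofList (l : List ℕ) : (ofList l).toList = l := by
  induction l with
  | nil => rfl
  | cons a l ih => exact congrArg (a :: ·) ih

/-- The rows form a systematic generator matrix of a self-orthogonal code. Orthogonality is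
expressed by the count of the rows that are orthogonal to all rows. -/
structure IsSystematic (rows : List ℕ) : Prop where
  length_eq : rows.length = 11
  castAdd : ∀ i j : Fin 11, coord (rows.getD i 0) j = if i = j then 1 else 0
  lt : ∀ h ∈ rows, h < 2 ^ 22
  hits_eq : (MaskTree.ofList rows).hits (systemOf rows fun _ => false) = 11

variable {rows : List ℕ}

lemma satisfies_iff {H : List (ℕ × Bool)} {y : ℕ} : Satisfies H y ↔
    ∀ h ∈ H, ∑ j : Fin 22, coord h.1 j * binaryVec y j = bif h.2 then 1 else 0 :=
  forall₂_congr fun h _ => by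
    rw [← Fin.sum_univ_eq_sum_range fun j => coord h.1 j * coord y j]
    rfl

lemma IsSystematic.forall_mem_systemOf (h : IsSystematic rows) {s : ℕ → Bool}
    {p : ℕ × Bool → Prop} : (∀ t ∈ systemOf rows s, p t) ↔
      ∀ i : Fin 11, p (rows.getD i 0, s (rows.getD i 0)) := by
  rw [systemOf, List.forall_mem_map, List.forall_mem_iff_getElem]
  constructor
  · intro H i
    have hi : (i : ℕ) < rows.length := by rw [h.length_eq]; exact i.isLt
    rw [List.getD_eq_getElem _ _ hi]
    exact H i hi
  · intro H i hi
    have h' := H ⟨i, by rw [← h.length_eq]; exact hi⟩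
    rwa [List.getD_eq_getElem _ _ hi] at h'

lemma IsSystematic.getD_mem (h : IsSystematic rows) (i : Fin 11) : rows.getD i 0 ∈ rows := by
  have hi : (i : ℕ) < rows.length := by rw [h.length_eq]; exact i.isLt
  rw [List.getD_eq_getElem _ _ hi]
  exact List.getElem_mem hi

lemma IsSystematic.orthogonal (h : IsSystematic rows) (i i' : Fin 11) :
    ∑ j : Fin 22, coord (rows.getD i 0) j * coord (rows.getD i' 0) j = 0 := by
  have hall := h.hits_eq
  rw [MaskTree.hits_eq_countP _ (by rw [MaskTree.toList_ofList]; exact h.lt),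
    MaskTree.toList_ofList, ← h.length_eq, List.countP_eq_length] at hall
  have hs := satisfies_iff.1 (of_decide_eq_true (hall _ (h.getD_mem i')))
  exact h.forall_mem_systemOf.1 hs i

lemma IsSystematic.mem_binaryCode (h : IsSystematic rows) (x : Fin 22 → ZMod 2) :
    x ∈ binaryCode rows ↔ ∀ i : Fin 11, ∑ j : Fin 22, x j * coord (rows.getD i 0) j = 0 :=
  mem_span_iff_of_systematic (n := 11) (RingHom.id _) (g := fun i => binaryVec (rows.getD i 0))
    h.castAdd h.orthogonal x

lemma IsSystematic.isSelfDual (h : IsSystematic rows) : IsSelfDual (binaryCode rows) :=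
  mem_span_iff_forall_mem_of_systematic (n := 11) (RingHom.id _)
    (g := fun i => binaryVec (rows.getD i 0)) h.castAdd h.orthogonal

lemma IsSystematic.translateCount_eq_wordCount (h : IsSystematic rows) {s : ℕ → Bool} {y w : ℕ}
    (hy : Satisfies (systemOf rows s) y) (hw : w ≤ 10) :
    translateCount (cubicConstruction (binaryCode rows) quaternaryCode)
      (repeatWord (binaryVec y)) w = wordCount rows s w := by
  classical
  rw [wordCount, hits_add_hits _ _ hw, ← sum_quaternaryCode, translateCount_cubicConstruction]
  refine sum_congr rfl fun u _ => ?_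
  rw [solutionCount]
  refine congrArg card (filter_congr fun x _ => and_congr ?_ Iff.rfl)
  rw [satisfies_iff, h.forall_mem_systemOf] at hy
  rw [h.mem_binaryCode, h.forall_mem_systemOf]
  refine forall_congr' fun i => ?_
  have h2 : ∀ a b : ZMod 2, a + b = 0 ↔ b = a := by decide
  have he : ∑ j : Fin 22, (binaryVec y + x) j * coord (rows.getD i 0) j =
      ∑ j : Fin 22, coord (rows.getD i 0) j * binaryVec y j +
        ∑ j : Fin 22, coord (rows.getD i 0) j * x j := by
    rw [← sum_add_distrib]
    exact sum_congr rfl fun j _ => by rw [Pi.add_apply]; ring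
  rw [he, h2, hy i]

lemma ones_eq_hammingNorm (y : ℕ) : ones 22 y = hammingNorm (binaryVec y) := by
  rw [hammingNorm_eq_sum, ones, ← Fin.sum_univ_eq_sum_range fun j => bif y.testBit j then 1 else 0]
  refine sum_congr rfl fun j _ => ?_
  rw [binaryVec, coord]
  cases y.testBit j <;> simp

lemma IsSystematic.sum_mul_eq_zero_iff (h : IsSystematic rows) {y : ℕ}
    (hy : Satisfies (systemOf rows isSinglyEven) y) {x : Fin 22 → ZMod 2}
    (hx : x ∈ binaryCode rows) : ∑ j, binaryVec y j * x j = 0 ↔ 4 ∣ hammingNorm x := by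
  have hd := h.isSelfDual
  rw [satisfies_iff, h.forall_mem_systemOf] at hy
  rw [binaryCode] at hx
  induction hx using Submodule.span_induction with
  | mem x hx =>
    obtain ⟨i, rfl⟩ := hx
    rw [← ones_eq_hammingNorm, Nat.dvd_iff_mod_eq_zero]
    have hi := hy i
    rw [sum_congr rfl fun j _ => mul_comm _ _] at hi
    change ∑ j, binaryVec y j * coord (rows.getD i 0) j = 0 ↔ _
    rw [hi, isSinglyEven]
    rcases hb : Nat.beq (ones 22 (rows.getD i 0) % 4) 0 with _ | _
    · have := Nat.ne_of_beq_eq_false hb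
      simpa using this
    · have := Nat.eq_of_beq_eq_true hb
      simpa using this
  | zero => simp
  | add a b ha hb iha ihb =>
    have h1 := hammingNorm_add_add a b
    have h2 := (two_dvd_hammingNorm_iff (a * b)).2 (hd.sum_mul_eq_zero ha hb)
    have h3 := hd.two_dvd_hammingNorm ha
    have h4 := hd.two_dvd_hammingNorm hb
    have h5 : ∀ s t : ZMod 2, s + t = 0 ↔ (s = 0 ↔ t = 0) := by decide
    simp only [Pi.add_apply, mul_add, sum_add_distrib]
    rw [h5]
    refine (iff_congr iha ihb).trans ?_
    omega
  | smul c a _ iha =>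
    rcases eq_zero_or_one c with rfl | rfl
    · simp
    · rwa [one_smul]

/-- The vector whose inner product with each row of a systematic matrix tells whether the weight of
the row is not divisible by four. -/
def shadowVector (rows : List ℕ) : ℕ :=
  rows.foldr (fun h y => 2 * y + bif isSinglyEven h then 1 else 0) 0

/-- The finite computation behind the properties of the cubic code with binary component generated
by `rows`: its minimum weight is at least 12, and its shadow has no vectors of weight 1 and 5 and
`α` vectors of weight 9. -/
structure IsCertified (α : ℕ) (rows : List ℕ) : Prop extends IsSystematic rows where
  satisfies : Satisfies (systemOf rows isSinglyEven) (shadowVector rows)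
  ones_mod_four : ones 22 (shadowVector rows) % 4 = 3
  wordCount_even : ∀ w ∈ [2, 4, 6, 8, 10], wordCount rows (fun _ => false) w = 0
  wordCount_one : wordCount rows isSinglyEven 1 = 0
  wordCount_five : wordCount rows isSinglyEven 5 = 0
  wordCount_nine : wordCount rows isSinglyEven 9 = α

/-- The cubic code with binary component generated by `rows`. -/
noncomputable def cubicCode (rows : List ℕ) : BinaryCode (Fin 3 × Fin 22) :=
  cubicConstruction (binaryCode rows) quaternaryCode

lemma hammingNorm_ne_of_weightCount_eq_zero {ι : Type*} [Fintype ι] {C : BinaryCode ι} {w : ℕ}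
    (h : weightCount C w = 0) {c : ι → ZMod 2} (hc : c ∈ C) : hammingNorm c ≠ w := by
  classical
  rw [weightCount_eq_card, card_eq_zero, filter_eq_empty_iff] at h
  exact fun hw => h (mem_univ c) ⟨hc, hw⟩

namespace IsCertified
variable {α : ℕ}

lemma isTypeI (h : IsCertified α rows) : IsTypeI (binaryCode rows) := by
  refine ⟨h.isSelfDual, ?_⟩
  by_contra! H
  -- otherwise the shadow vector is orthogonal to the code, but its weight is odd
  have hy : binaryVec (shadowVector rows) ∈ binaryCode rows :=
    (h.isSelfDual _).2 fun v hv => (h.sum_mul_eq_zero_iff h.satisfies hv).2 (H v hv)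
  have h2 := h.isSelfDual.two_dvd_hammingNorm hy
  have h3 := h.ones_mod_four
  rw [ones_eq_hammingNorm] at h3
  omega

lemma isSelfDual_cubicCode (h : IsCertified α rows) : IsSelfDual (cubicCode rows) :=
  isSelfDual_cubicConstruction h.isSelfDual isHermitianSelfDual_quaternaryCode

lemma weightCount_even (h : IsCertified α rows) :
    ∀ w ∈ [2, 4, 6, 8, 10], weightCount (cubicCode rows) w = 0 := by
  intro w hw
  have h0 : repeatWord (binaryVec 0) = 0 := funext fun p => coord_zero p.2
  have hs : Satisfies (systemOf rows fun _ => false) 0 := by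
    intro t ht
    obtain ⟨_, -, rfl⟩ := List.mem_map.1 ht
    simp [coord_zero]
  have key := h.translateCount_eq_wordCount hs (w := w) (by fin_cases hw <;> norm_num)
  rw [h0, translateCount_zero, h.wordCount_even w hw] at key
  exact key

lemma weightCount_twelve_fourteen (h : IsCertified α rows) :
    (weightCount (cubicCode rows) 12 : ℤ) = 858 + 8 * α ∧
      (weightCount (cubicCode rows) 14 : ℤ) = 18678 - 24 * α := by
  have hp : binaryPart (repeatWord (binaryVec (shadowVector rows))) =
      binaryVec (shadowVector rows) := by
    have h3 : ∀ t : ZMod 2, t + t + t = t := by decide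
    exact funext fun j => h3 _
  have hq : quaternaryPart (repeatWord (binaryVec (shadowVector rows))) = 0 := by
    have h2 : ∀ t : ZMod 2, t + t = 0 := by decide
    exact funext fun j => quaternary_eq_zero.2 ⟨h2 _, h2 _⟩
  have he := h.weightCount_even
  have key := h.isSelfDual_cubicCode.weightCount_of_shadow (by simp)
    (s := repeatWord (binaryVec (shadowVector rows)))
    (fun c hc => by
      rw [sum_repeatWord_mul, four_dvd_hammingNorm_iff h.isSelfDual
        isHermitianSelfDual_quaternaryCode hc]
      exact h.sum_mul_eq_zero_iff h.satisfies (mem_cubicConstruction.1 hc).1)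
    (by
      have := h.ones_mod_four
      rw [ones_eq_hammingNorm] at this
      rw [hammingNorm_eq_cubicWeight, hp, hq, cubicWeight_zero_right]
      omega)
    (he 2 (by decide)) (he 4 (by decide)) (he 6 (by decide)) (he 8 (by decide))
    (he 10 (by decide))
    ((h.translateCount_eq_wordCount h.satisfies (by norm_num)).trans h.wordCount_one)
    ((h.translateCount_eq_wordCount h.satisfies (by norm_num)).trans h.wordCount_five)
  rwa [cubicCode, h.translateCount_eq_wordCount h.satisfies (by norm_num), h.wordCount_nine] at key

lemma weightCount_odd (h : IsCertified α rows) {w : ℕ} (hw : ¬ 2 ∣ w) :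
    weightCount (cubicCode rows) w = 0 := by
  classical
  rw [weightCount_eq_card, card_eq_zero, filter_eq_empty_iff]
  rintro c - ⟨hc, rfl⟩
  exact hw (h.isSelfDual_cubicCode.two_dvd_hammingNorm hc)

lemma weightCount_of_lt_twelve (h : IsCertified α rows) {w : ℕ} (hw : 0 < w) (hw' : w < 12) :
    weightCount (cubicCode rows) w = 0 := by
  by_cases h2 : 2 ∣ w
  · exact h.weightCount_even w (by simp only [List.mem_cons, List.not_mem_nil]; omega)
  · exact h.weightCount_odd h2

lemma hasW1 (h : IsCertified α rows) : HasW1 (cubicCode rows) α := by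
  intro i hi
  have hc : (weightEnumerator (cubicCode rows)).coeff i = weightCount (cubicCode rows) i := by
    rw [weightEnumerator, Polynomial.finsetSum_coeff]
    simp only [Polynomial.coeff_monomial]
    rw [sum_ite_eq', if_pos]
    rw [mem_range]
    simp
    omega
  rw [hc, Polynomial.coeff_add, Polynomial.coeff_add, Polynomial.coeff_monomial,
    Polynomial.coeff_monomial, Polynomial.coeff_one]
  obtain ⟨h12, h14⟩ := h.weightCount_twelve_fourteen
  rcases Nat.eq_zero_or_pos i with rfl | h0
  · simp [weightCount_zero]
  by_cases h2 : i = 12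
  · simp [h2, h12]
  by_cases h4 : i = 14
  · simp [h4, h14]
  have : weightCount (cubicCode rows) i = 0 := by
    by_cases hi' : i < 12
    · exact h.weightCount_of_lt_twelve h0 hi'
    · exact h.weightCount_odd (by omega)
  rw [this, if_neg (by omega), if_neg (by omega), if_neg (by omega)]
  simp

lemma exists_hammingNorm_eq_twelve (h : IsCertified α rows) :
    ∃ c ∈ cubicCode rows, hammingNorm c = 12 := by
  classical
  by_contra! H
  have h12 := h.weightCount_twelve_fourteen.1
  rw [weightCount_eq_card, filter_false_of_mem fun c _ hc => H c hc.1 hc.2, card_empty] at h12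
  omega

lemma hasParameters (h : IsCertified α rows) : HasParameters (cubicCode rows) 66 33 12 := by
  have hn : Fintype.card (Fin 3 × Fin 22) = 66 := by simp
  refine ⟨hn, ?_, ?_, ?_⟩
  · have := h.isSelfDual_cubicCode.two_mul_finrank
    rw [hn] at this
    omega
  · obtain ⟨c, hc, h12⟩ := h.exists_hammingNorm_eq_twelve
    refine ⟨c, hc, 0, Submodule.zero_mem _, ?_, (hammingDist_zero_right c).trans h12⟩
    rintro rfl
    rw [hammingNorm_zero] at h12
    exact absurd h12 (by norm_num)
  · rintro r ⟨u, hu, v, hv, huv, rfl⟩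
    by_contra! hlt
    rw [hammingDist_eq_hammingNorm] at hlt
    have hpos : 0 < hammingNorm (-u + v) :=
      hammingNorm_pos_iff.2 fun h0 => huv (neg_add_eq_zero.1 h0)
    exact hammingNorm_ne_of_weightCount_eq_zero (h.weightCount_of_lt_twelve hpos hlt)
      (Submodule.add_mem _ (Submodule.neg_mem _ hu) hv) rfl

end IsCertified

/-- Equivalent codes have the same weight distribution. -/
lemma Equivalent.weightCount_eq {ι : Type*} [Fintype ι] {C D : BinaryCode ι} (h : Equivalent C D)
    (i : ℕ) : weightCount C i = weightCount D i := by
  classical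
  obtain ⟨σ, hσ⟩ := h
  rw [weightCount_eq_card, weightCount_eq_card]
  refine (card_equiv (σ.arrowCongr (Equiv.refl (ZMod 2))).symm fun c => ?_).symm
  have hc : (σ.arrowCongr (Equiv.refl (ZMod 2))).symm c = c ∘ σ := rfl
  rw [hc, mem_filter, mem_filter, hσ]
  have : hammingNorm (c ∘ σ) = hammingNorm c := by
    rw [hammingNorm_eq_sum, hammingNorm_eq_sum]
    exact Equiv.sum_comp σ fun i => if c i = 0 then 0 else 1
  rw [this]
  simp

/-- The parameter of a code with weight enumerator `W₁` is an invariant of its equivalence class. -/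
lemma HasW1.eq_of_equivalent {C D : BinaryCode (Fin 3 × Fin 22)} {α β : ℕ} (hC : HasW1 C α)
    (hD : HasW1 D β) (h : Equivalent C D) : α = β := by
  have he : weightEnumerator C = weightEnumerator D := by
    simp only [weightEnumerator, h.weightCount_eq]
  have h1 := hC 12 (by norm_num)
  rw [he, hD 12 (by norm_num)] at h1
  simp only [Polynomial.coeff_add, Polynomial.coeff_monomial, Polynomial.coeff_one] at h1
  norm_num at h1
  omega

/-! ### The codes -/

/-- For each `α` the rows, as bit masks, of a systematic generator matrix of a self-dual binary code
whose cubic construction with `quaternaryCode` has parameter `α`. -/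
def codeTable : List (ℕ × List ℕ) :=
  [(6, [4155393, 3178498, 555012, 4132872, 3610640, 151584, 471104, 1564800, 2613504, 283136,
    87040]),
   (8, [1785857, 4143106, 548868, 2256904, 3975184, 3311648, 2134080, 1618048, 2455808, 1337856,
    3572736]),
   (9, [421889, 2834434, 1167364, 3571720, 4130832, 2742304, 1407040, 1908864, 2666752, 2431488,
    2538496]),
   (10, [770049, 3028994, 2353156, 425992, 4145168, 542752, 3229760, 1968256, 2349312, 592384,
    914432]),
   (11, [3346433, 2578434, 3323908, 1687560, 4034576, 2017312, 2279488, 1798272, 229632, 2746880,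
    3163136]),
   (12, [2041857, 1785858, 1982468, 3110920, 1722384, 1576992, 1183808, 2789504, 1728768, 1047040,
    2485248]),
   (13, [671745, 155650, 409604, 2134024, 2942992, 927776, 3178560, 149632, 2195712, 4028928,
    1965056]),
   (14, [114689, 2422786, 3414020, 2207752, 1060880, 3774496, 1028160, 2672768, 1530112, 788992,
    1764352]),
   (15, [477185, 4038658, 114692, 1060872, 3989520, 3418144, 2490432, 2455680, 606464, 3496448,
    2313216]),
   (16, [2930689, 1292290, 223236, 2381832, 1783824, 2164768, 28736, 2875520, 844032, 1606144,
    2231296]),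
   (17, [2166785, 3846146, 3977220, 3717128, 3211280, 419872, 1118272, 4118656, 57600, 3174912,
    549888]),
   (18, [2758657, 3876866, 2078724, 1368072, 3246096, 350240, 1951808, 1536128, 1786112, 2564608,
    2595840]),
   (19, [235521, 3287042, 432132, 872456, 1212432, 2261024, 172096, 1034368, 3188992, 694784,
    187392]),
   (20, [2666497, 1157122, 172036, 831496, 1171472, 682016, 706624, 1067136, 2924800, 2363904,
    84992]),
   (21, [2752513, 1423362, 280580, 2093064, 3002384, 1177632, 4046912, 3666048, 2908416, 3985920,
    4019200]),
   (22, [495617, 3209218, 571396, 548872, 2629648, 493600, 71744, 268416, 3725568, 1581568,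
    138240]),
   (23, [2666497, 1157122, 57348, 831496, 1286160, 682016, 706624, 1181824, 2924800, 2363904,
    199680]),
   (24, [3188737, 813058, 1777668, 843784, 3276816, 282656, 2826304, 3983488, 3690752, 3936768,
    3212288]),
   (25, [468993, 1318914, 1208324, 927752, 436240, 2721824, 3121216, 2500736, 286976, 1462784,
    275456]),
   (26, [3530753, 3276802, 274436, 604168, 622608, 100384, 28736, 1564800, 381184, 571904,
    2614272]),
   (27, [2236417, 4009986, 1734660, 561160, 1644560, 698400, 401472, 178304, 751872, 4133376,
    1131520]),
   (28, [83969, 1441794, 3332100, 469000, 3358736, 3977248, 1294400, 985216, 3913984, 1266176,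
    2528256]),
   (29, [3407873, 720898, 1343492, 213000, 3178512, 671776, 618560, 14464, 616704, 2392576,
    613376]),
   (30, [1466369, 63490, 100356, 942088, 2334736, 96288, 2490432, 102528, 1687808, 2073088,
    2466816]),
   (31, [3567617, 1576962, 90116, 3018760, 26640, 3659808, 1704000, 3670144, 3651840, 1835520,
    58368]),
   (32, [1853441, 3174402, 1028100, 4130824, 3198992, 4044832, 3989568, 385152, 647424, 2902528,
    3324928]),
   (33, [3414017, 579586, 3907588, 2930696, 1280016, 3751968, 3047488, 2207872, 3502336, 479744,
    261120]),
   (34, [851969, 1509378, 331780, 1980424, 335888, 3276832, 3196992, 1212544, 1784064, 1196544,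
    2280448]),
   (35, [2367489, 3897346, 3407876, 2424840, 165904, 2375712, 3928128, 1929344, 2883840, 2363904,
    3800064]),
   (36, [1845249, 1994754, 3670020, 200712, 3196944, 1658912, 2672704, 161920, 1786112, 416256,
    1606656]),
   (37, [3375105, 3311618, 3043332, 954376, 172048, 2678816, 1208384, 1382528, 1466624, 2595328,
    181248]),
   (38, [1028097, 2029570, 1669124, 2793480, 3338256, 2127904, 1558592, 3457152, 3555584, 3160576,
    2790400]),
   (39, [3596289, 2068482, 1636356, 96264, 2349072, 2508832, 1232960, 1841280, 3694848, 2822656,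
    1516544]),
   (40, [3248129, 401410, 3098628, 2449416, 3198992, 86048, 2844736, 114816, 1130752, 795136,
    273408]),
   (41, [534529, 2363394, 2490372, 124936, 1097744, 2232352, 591936, 1140864, 1157376, 397824,
    599040]),
   (42, [1054721, 450562, 3540996, 1282056, 1615888, 2375712, 1992768, 235648, 1116416, 967168,
    3296256]),
   (43, [86017, 401410, 3098628, 2449416, 3198992, 3248160, 2844736, 114816, 1130752, 795136,
    273408]),
   (44, [3141633, 1046530, 1376260, 1896456, 1122320, 1130528, 3012672, 1147008, 1118464, 2230784,
    1639424]),
   (45, [1802241, 4118530, 2107396, 1015816, 2201616, 3495968, 669760, 594048, 200960, 770560,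
    2765824]),
   (46, [1693697, 1181698, 282628, 2895880, 2908176, 165920, 28736, 1822848, 198912, 678400,
    2118656]),
   (47, [2564097, 739330, 1208324, 3022856, 907280, 4038688, 727104, 2551936, 2382080, 2742784,
    4183040]),
   (48, [2834433, 2705410, 385028, 3670024, 3477520, 3248160, 3469376, 1710208, 3223808, 2626048,
    3365888]),
   (49, [3059713, 2957314, 1128452, 331784, 3516432, 378912, 1425472, 757888, 1067264, 2564608,
    3218432]),
   (50, [372737, 1374210, 2068484, 1036296, 2570256, 1855520, 3469376, 4016256, 172288, 3660288,
    3759104]),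
   (51, [3092481, 1079298, 1515524, 2066440, 2207760, 858144, 3565632, 3442816, 2908416, 1307136,
    1688576]),
   (52, [1638401, 1435650, 3098628, 3270664, 598032, 2496544, 1128512, 1630336, 3617024, 1305088,
    3116032]),
   (53, [2850817, 28674, 1703940, 22536, 14352, 3047456, 26688, 2424960, 1016064, 1606144,
    1213440]),
   (54, [593921, 1282050, 2066436, 3006472, 3901456, 3565600, 1089600, 632960, 172288, 1741312,
    1821696]),
   (56, [141313, 114690, 534532, 2461704, 663568, 344096, 1413184, 3149952, 3506432, 311808,
    658432]),
   (57, [1650689, 1697794, 3581956, 3536904, 1536016, 1447968, 829504, 1237120, 2736384, 2994688,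
    2565120]),
   (59, [561153, 2230274, 1376260, 372744, 149520, 1122336, 1318976, 2244736, 864512, 2116096,
    893952]),
   (60, [794625, 2629634, 1097732, 3432456, 2484240, 2951200, 718912, 71808, 198912, 782848,
    3449856]),
   (62, [296961, 2201602, 2232324, 2328584, 1957904, 1108000, 862272, 870528, 1902848, 559616,
    236544]),
   (65, [3276801, 83970, 3995652, 591880, 3221520, 4059168, 100416, 1187968, 71936, 2236928,
    330752]),
   (68, [790529, 2625538, 4130820, 1576968, 57360, 3610656, 571456, 659584, 579840, 555520,
    594944]),
   (69, [819201, 790530, 3725316, 1835016, 3659792, 1488928, 26688, 2902144, 2107648, 2318848,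
    1424384]),
   (71, [28673, 4044802, 3463172, 2121736, 720912, 1073184, 3651648, 4110464, 57600, 287232,
    27648])]

lemma isCertified_iff {α : ℕ} {rows : List ℕ} : IsCertified α rows ↔
    (rows.length = 11 ∧
    (∀ i j : Fin 11, coord (rows.getD i 0) j = if i = j then 1 else 0) ∧
    (∀ h ∈ rows, h < 2 ^ 22) ∧
    (MaskTree.ofList rows).hits (systemOf rows fun _ => false) = 11) ∧
    Satisfies (systemOf rows isSinglyEven) (shadowVector rows) ∧
    ones 22 (shadowVector rows) % 4 = 3 ∧
    (∀ w ∈ [2, 4, 6, 8, 10], wordCount rows (fun _ => false) w = 0) ∧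
    wordCount rows isSinglyEven 1 = 0 ∧ wordCount rows isSinglyEven 5 = 0 ∧
    wordCount rows isSinglyEven 9 = α :=
  ⟨fun ⟨⟨a, b, c, d⟩, e, f, g, h, i, j⟩ => ⟨⟨a, b, c, d⟩, e, f, g, h, i, j⟩,
    fun ⟨⟨a, b, c, d⟩, e, f, g, h, i, j⟩ => ⟨⟨a, b, c, d⟩, e, f, g, h, i, j⟩⟩

noncomputable instance (α : ℕ) (rows : List ℕ) : Decidable (IsCertified α rows) :=
  decidable_of_iff' _ isCertified_iff

/-- The computation for all codes. It is one statement so that the quaternary words of small weight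
are enumerated only once. -/
lemma isCertified_of_mem_codeTable : ∀ c ∈ codeTable, IsCertified c.1 c.2 := by
  set_option maxRecDepth 100000 in decide +kernel

lemma exists_mem_codeTable : ∀ α ∈ foundValues, ∃ c ∈ codeTable, c.1 = α := by decide +kernel

end CubicCode

theorem mainTheorem3 :
    CubicCode.foundValues.card = 57 ∧
    (CubicCode.foundValues \ CubicCode.previousValues).card = 50 ∧
    ∃ C : ℕ → CubicCode.BinaryCode (Fin 3 × Fin 22),
      (∀ α ∈ CubicCode.foundValues,
        CubicCode.IsCubic (C α) ∧
        CubicCode.IsSelfDual (C α) ∧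
        CubicCode.IsTypeI (C α) ∧
        CubicCode.HasParameters (C α) 66 33 12 ∧
        CubicCode.HasW1 (C α) α ∧
        ∃ (C₁ : CubicCode.BinaryCode (Fin 22))
          (C₂ : Submodule CubicCode.F4 (Fin 22 → CubicCode.F4)),
          CubicCode.IsTypeI C₁ ∧ CubicCode.IsHermitianSelfDual C₂ ∧
          C α = CubicCode.cubicConstruction C₁ C₂) ∧
      (∀ α ∈ CubicCode.foundValues, ∀ β ∈ CubicCode.foundValues, α ≠ β →
        ¬ CubicCode.Equivalent (C α) (C β)) ∧
      (∀ α ∈ CubicCode.foundValues \ CubicCode.previousValues,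
        ∀ β ∈ CubicCode.previousValues, ∀ D : CubicCode.BinaryCode (Fin 3 × Fin 22),
          CubicCode.HasW1 D β → ¬ CubicCode.Equivalent (C α) D) := by
  classical
  have hex : ∀ α, ∃ rows, α ∈ CubicCode.foundValues → CubicCode.IsCertified α rows := by
    intro α
    by_cases hα : α ∈ CubicCode.foundValues
    · obtain ⟨c, hc, rfl⟩ := CubicCode.exists_mem_codeTable α hα
      exact ⟨c.2, fun _ => CubicCode.isCertified_of_mem_codeTable c hc⟩
    · exact ⟨[], fun h => absurd h hα⟩
  choose rows hrows using hex
  refine ⟨by decide +kernel, by decide +kernel, fun α => CubicCode.cubicCode (rows α), ?_, ?_, ?_⟩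
  · intro α hα
    have h := hrows α hα
    have hI := CubicCode.isTypeI_cubicConstruction h.isTypeI
      CubicCode.isHermitianSelfDual_quaternaryCode
    exact ⟨CubicCode.isCubic_cubicConstruction _ _, hI.1, hI, h.hasParameters, h.hasW1, _, _,
      h.isTypeI, CubicCode.isHermitianSelfDual_quaternaryCode, rfl⟩
  · intro α hα β hβ hne h
    exact hne ((hrows α hα).hasW1.eq_of_equivalent (hrows β hβ).hasW1 h)
  · intro α hα β hβ D hD h
    rw [Finset.mem_sdiff] at hα
    rw [(hrows α hα.1).hasW1.eq_of_equivalent hD h] at hα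
    exact hα.2 hβ
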